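/- **Setting.** Let $R$ be a measurable space with countably generated $\sigma$-algebra and $H$ a separable metric space with its Borel $\sigma$-algebra (e.g. Borel subsets of $\mathbb R^{d_k}$ and $\mathbb R^{d_y}$); put $E=R\times H$, $\Omega=H^{\mathbb Z}$, $Y_n(\omega)=\omega(n)$ and $(z\omega)(n)=\omega(n+1)$. Let $\mathbb P$ be a probability measure on $\Omega$, let $M(\omega,x,dx')$ be a Markov kernel from $\Omega\times E$ to $E$, let $\epsilon:\Omega\to\mathbb R$ be measurable (e.g. a positive constant), and let $W(\omega,x)=\mathbb I_{R\times B_{\epsilon(\omega)}(Y_1(\omega))}(x)$. Let $N\in\mathbb N$, let $(x^i(\omega))_{i\ge1}$ be a sequence of particles in $E$ depending measurably on $\omega$, and put $T_\omega=\inf\{p\ge N:\sum_{i=1}^pW(\omega,x^i(\omega))\ge N\}$ and $m_k=m_k(\omega)=T_{z^k\omega}-1$. For $x\in E^{m}$ let $\mathbf W^{m}(\omega,x)=\frac1{m}\sum_{j}W(\omega,x^j)$, and let $\mathbf M^{m,m'}(\omega,x,\cdot)$ be the $m'$-fold product of the law $\sum_jW(\omega,x^j)M(\omega,x^j,\cdot)\big/\sum_jW(\omega,x^j)$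 (read as the zero measure if all weights vanish). Let $Q^\omega(x,dx')=W(\omega,x)M(\omega,x,dx')$, $Q_0=I$, $Q_{n+1}^\omega=Q^\omega Q_n^{z\omega}$. **Assumptions.** (B1) $z$ preserves $\mathbb P$ and is ergodic. (B2) With $M^\omega(W)(x)=\int M(\omega,x,dx')W(z\omega,x')$ there are $\Delta_1<\infty$, constants $0<\epsilon_-,\epsilon_+<\infty$ and a probability measure $\nu$ on $E$ such that $M^\omega(W)(x)/M^\omega(W)(u)\le\Delta_1$ and $\epsilon_-\nu\le M(\omega,x,\cdot)\le\epsilon_+\nu$ for all $\omega,x,u$; moreover $\inf_\omega\nu Q^\omega(1)=\inf_\omega\nu(W(\omega,\cdot))>0$. (B3) $N>1$, and the $T_\omega$ are finite, uniformly in $\omega$: $\sup_{\omega}T_\omega<\infty$. **The class.** A Markov kernel $\widetilde{\mathbf M}^{m,m'}$ from $\Omega\times E^{m}$ to $E^{m'}$ belongs to $\mathbb M^{m,m'}$ if there are constants $0<\tilde\epsilon_-,\tilde\epsilon_+<\infty$ and a probability measure $\tilde\nu$ on $E^{m'}$ with $\tilde\epsilon_-\tilde\nu\le\widetilde{\mathbf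 M}^{m,m'}(\omega,x,\cdot)\le\tilde\epsilon_+\tilde\nu$ for all $(\omega,x)$, $\nu^{\otimes m'}\ll\tilde\nu$ and $\int(d\nu^{\otimes m'}/d\tilde\nu)^2\,d\tilde\nu<\infty$. For a family $\widetilde{\mathbf M}=(\widetilde{\mathbf M}^{m,m'})_{m,m'}$ with $\widetilde{\mathbf M}^{T_\omega-1,T_{z\omega}-1}\in\mathbb M^{T_\omega-1,T_{z\omega}-1}$ for all $\omega$, let $\phi^{\omega,m,m'}(x,\cdot)=d\mathbf M^{m,m'}(\omega,x,\cdot)/d\widetilde{\mathbf M}^{m,m'}(\omega,x,\cdot)$, $$\mathbf R^{m,m'}(\omega,x,dx')=\mathbf W^{m}(\omega,x)^2\,\phi^{\omega,m,m'}(x,x')^2\,\widetilde{\mathbf M}^{m,m'}(\omega,x,dx'),$$ let $\mathbf R_n^\omega$ be the composition of the kernels $\mathbf R^{m_k,m_{k+1}}(z^k\omega,\cdot,\cdot)$, $k=0,\dots,n-1$, and for a probability measure $\mu$ on $E$ let $$\widetilde{\mathcal V}_n^\omega=\frac{\mu^{\otimes(T_\omega-1)}\mathbf R_n^\omega(1)}{\big(\mu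 Q_n^\omega(1)\big)^2}.$$ **Claim.** Assume (B1), (B2), (B3). There is a real constant $\Lambda$ such that for every probability measure $\mu$ on $E$, $\frac1n\log\mu Q_n^\omega(1)\to\Lambda$; and for each such family $\widetilde{\mathbf M}$ there are real constants $\Xi$ and $\Upsilon=\Xi-2\Lambda\ge0$, depending on $\widetilde{\mathbf M}$ but not on $\mu$, such that for every probability measure $\mu$ on $E$ $$\tfrac1n\log\mu^{\otimes(T_\omega-1)}\mathbf R_n^\omega(1)\to\Xi,\qquad \tfrac1n\log\widetilde{\mathcal V}_n^\omega\to\Upsilon\qquad(n\to\infty).$$ All three limits hold for $\mathbb P$-almost every $\omega$ with $\mu(W(\omega,\cdot))>0$ (for the other $\omega$ the ratio $\widetilde{\mathcal V}_n^\omega$ is $0/0$ for $n\ge1$), and for these $\omega$ the quantities inside the logarithms are positive and finite for all $n$. -/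

import Mathlib

open MeasureTheory ProbabilityTheory Filter Topology
open scoped ENNReal NNReal

noncomputable section

namespace AliveFilter

/-- The shift on doubly infinite observation sequences, `(z ω)(n) = ω (n + 1)`. -/
def shift {H : Type*} (ω : ℤ → H) : ℤ → H := fun n => ω (n + 1)

/-- The data of an alive particle filter for a hidden Markov model with hidden states in `S` and
observations in `H`; the particles live in `S × H`. The particle target `N`, the (possibly
observation-dependent) radius of the acceptance ball, the transition `M (ω, x, dx')`, and, for each
`ω`, the sequence `x¹, x², …` of proposed particles whose weights determine the stopping time. -/
structure Model (S H : Type*) [MeasurableSpace S] [MeasurableSpace H] where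
  N : ℕ
  radius : (ℤ → H) → ℝ
  measurable_radius : Measurable radius
  M : Kernel ((ℤ → H) × (S × H)) (S × H)
  markov_M : IsMarkovKernel M
  particle : (ℤ → H) → ℕ → S × H
  measurable_particle : Measurable particle

section Basic

variable {S H : Type*} [MeasurableSpace S] [MeasurableSpace H] [MetricSpace H]

/-- The weight `W (ω, x)`: the indicator of `S × B(Y₁(ω))`, where `Y₁(ω) = ω 1`. -/
def weight (A : Model S H) (ω : ℤ → H) (x : S × H) : ℝ≥0∞ :=
  Set.indicator {v : S × H | v.2 ∈ Metric.ball (ω 1) (A.radius ω)} (fun _ => 1) x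

/-- The set of `p ≥ N` such that at least `N` of the first `p` particles have non-zero weight. -/
def stopSet (A : Model S H) (ω : ℤ → H) : Set ℕ :=
  {p | A.N ≤ p ∧ (A.N : ℝ≥0∞) ≤ ∑ i ∈ Finset.range p, weight A ω (A.particle ω i)}

/-- The stopping time `T_ω = inf {p ≥ N : ∑_{i ≤ p} W (ω, xⁱ) ≥ N}`. -/
def stopTime (A : Model S H) (ω : ℤ → H) : ℕ := sInf (stopSet A ω)

/-- The number `T_ω - 1` of retained particles (the last sampled particle is deleted). -/
def size (A : Model S H) (ω : ℤ → H) : ℕ := stopTime A ω - 1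

/-- `Q (ω, x, dx') = W (ω, x) M (ω, x, dx')`. -/
def Q (A : Model S H) (ω : ℤ → H) (x : S × H) : Measure (S × H) :=
  weight A ω x • A.M (ω, x)

/-- `Q_n^ω(1)(x)`, with `Q_0 = I` and `Q_{n+1}^ω = Q^ω Q_n^{zω}`. -/
def Qiter (A : Model S H) : ℕ → (ℤ → H) → S × H → ℝ≥0∞
  | 0, _, _ => 1
  | n + 1, ω, x => ∫⁻ y, Qiter A n (shift ω) y ∂(Q A ω x)

/-- The averaged weight `𝐖^m (ω, x) = m⁻¹ ∑_j W (ω, xʲ)`. -/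
def avgWeight (A : Model S H) {m : ℕ} (ω : ℤ → H) (x : Fin m → S × H) : ℝ≥0∞ :=
  (m : ℝ≥0∞)⁻¹ * ∑ j, weight A ω (x j)

/-- The selection-mutation law `∑_j W (ω, xʲ) M (ω, xʲ, ·) / ∑_j W (ω, xʲ)`; it is the zero measure
if all the weights vanish. -/
def selMut (A : Model S H) {m : ℕ} (ω : ℤ → H) (x : Fin m → S × H) : Measure (S × H) :=
  (avgWeight A ω x)⁻¹ • ((m : ℝ≥0∞)⁻¹ • ∑ j, weight A ω (x j) • A.M (ω, x j))

/-- The particle transition `𝐌^{m₁,m₂} (ω, x, ·)`: `m₂` independent draws from `selMut`. -/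
def bigM (A : Model S H) {m₁ : ℕ} (m₂ : ℕ) (ω : ℤ → H) (x : Fin m₁ → S × H) :
    Measure (Fin m₂ → S × H) :=
  Measure.pi (fun _ : Fin m₂ => selMut A ω x)

/-- A family of alternative particle transitions, one for each pair of particle numbers. -/
abbrev Proposal (S H : Type*) [MeasurableSpace S] [MeasurableSpace H] :=
  (m₁ m₂ : ℕ) → Kernel ((ℤ → H) × (Fin m₁ → S × H)) (Fin m₂ → S × H)

/-- `φ^{ω,m₁,m₂} (x, ·)`: the density of `𝐌^{m₁,m₂} (ω, x, ·)` with respect to the alternative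
transition. -/
def phi (A : Model S H) (K : Proposal S H) {m₁ m₂ : ℕ} (ω : ℤ → H) (x : Fin m₁ → S × H) :
    (Fin m₂ → S × H) → ℝ≥0∞ :=
  (bigM A m₂ ω x).rnDeriv (K m₁ m₂ (ω, x))

/-- The second-moment kernel
`𝐑^{m₁,m₂} (ω, x, dx') = 𝐖^{m₁} (ω, x)² φ^{ω,m₁,m₂} (x, x')² 𝐌̃^{m₁,m₂} (ω, x, dx')`. -/
def bigR (A : Model S H) (K : Proposal S H) {m₁ : ℕ} (m₂ : ℕ) (ω : ℤ → H)
    (x : Fin m₁ → S × H) : Measure (Fin m₂ → S × H) :=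
  (K m₁ m₂ (ω, x)).withDensity (fun y => avgWeight A ω x ^ 2 * phi A K ω x y ^ 2)

/-- `𝐑_n^ω(1)(x)` along the particle numbers `T_ω - 1, T_{zω} - 1, …, T_{zⁿω} - 1`, with
`𝐑_0 = I` and `𝐑_{n+1}^ω = 𝐑^ω 𝐑_n^{zω}`. -/
def Riter (A : Model S H) (K : Proposal S H) :
    ℕ → (ω : ℤ → H) → (Fin (size A ω) → S × H) → ℝ≥0∞
  | 0, _, _ => 1
  | n + 1, ω, x => ∫⁻ y, Riter A K n (shift ω) y ∂(bigR A K (size A (shift ω)) ω x)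

/-- The normalising constant `μ Q_n^ω(1)`. -/
def normConst (A : Model S H) (μ : Measure (S × H)) (n : ℕ) (ω : ℤ → H) : ℝ≥0∞ :=
  ∫⁻ x, Qiter A n ω x ∂μ

/-- The second moment `μ^{⊗(T_ω - 1)} 𝐑_n^ω(1)` of its estimate. -/
def secondMoment (A : Model S H) (K : Proposal S H) (μ : Measure (S × H)) (n : ℕ)
    (ω : ℤ → H) : ℝ≥0∞ :=
  ∫⁻ x, Riter A K n ω x ∂(Measure.pi (fun _ : Fin (size A ω) => μ))

/-- The relative second moment `𝒱̃_n^ω`. -/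
def relSecondMoment (A : Model S H) (K : Proposal S H) (μ : Measure (S × H)) (n : ℕ)
    (ω : ℤ → H) : ℝ≥0∞ :=
  secondMoment A K μ n ω / normConst A μ n ω ^ 2

/-- The class `𝕄^{m₁,m₂}`, relative to the probability measure `ν` that minorises and majorises
`M`. -/
def MemClass (ν : Measure (S × H)) {m₁ m₂ : ℕ}
    (K : Kernel ((ℤ → H) × (Fin m₁ → S × H)) (Fin m₂ → S × H)) : Prop :=
  IsMarkovKernel K ∧
  ∃ (e₁ e₂ : ℝ≥0) (νt : Measure (Fin m₂ → S × H)), 0 < e₁ ∧ 0 < e₂ ∧ IsProbabilityMeasure νt ∧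
    (∀ ω x, e₁ • νt ≤ K (ω, x) ∧ K (ω, x) ≤ e₂ • νt) ∧
    Measure.pi (fun _ : Fin m₂ => ν) ≪ νt ∧
    ∫⁻ y, (Measure.pi (fun _ : Fin m₂ => ν)).rnDeriv νt y ^ 2 ∂νt < ∞

/-- `M^ω(W)(x) = ∫ M (ω, x, dx') W (zω, x')`. -/
def MW (A : Model S H) (ω : ℤ → H) (x : S × H) : ℝ≥0∞ :=
  ∫⁻ y, weight A (shift ω) y ∂(A.M (ω, x))

/-- The mixing condition: bounded ratios `M^ω(W)(x) / M^ω(W)(u)`, two-sided bounds of `M` by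
multiples of `ν`, and a lower bound for `ν Q^ω(1) = ν(W^ω)` that is uniform in `ω`. -/
def Mixing (A : Model S H) (ν : Measure (S × H)) : Prop :=
  (∃ Δ : ℝ≥0, ∀ ω x u, MW A ω x / MW A ω u ≤ Δ) ∧
  (∃ e₁ e₂ : ℝ≥0, 0 < e₁ ∧ 0 < e₂ ∧ ∀ ω x, e₁ • ν ≤ A.M (ω, x) ∧ A.M (ω, x) ≤ e₂ • ν) ∧
  (∃ g : ℝ≥0, 0 < g ∧ ∀ ω, (g : ℝ≥0∞) ≤ ∫⁻ x, weight A ω x ∂ν)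

/-- The running-time condition: `N > 1`, and the stopping times are finite, with a bound that is
uniform in `ω`. -/
def BoundedRunningTime (A : Model S H) : Prop :=
  1 < A.N ∧ (∀ ω, (stopSet A ω).Nonempty) ∧ ∃ C : ℕ, ∀ ω, stopTime A ω ≤ C

end Basic

/-- The sequence `a` is positive and finite, and `n⁻¹ log (a n) → c`. -/
def HasExponent (a : ℕ → ℝ≥0∞) (c : ℝ) : Prop :=
  (∀ n, a n ≠ 0 ∧ a n ≠ ∞) ∧
  Tendsto (fun n : ℕ => 1 / (n : ℝ) * Real.log (a n).toReal) atTop (𝓝 c)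

end AliveFilter

end

/-! Under the mixing condition one step of `Q` is comparable, with a constant uniform in `ω`, to the
rank-one kernel sending `x` to `weight A ω x • ν`. One step of `bigR` is likewise comparable to
`avgWeight A ω x ^ 2 • η`. Here `η` has density the square of `dν^{⊗m'}/dν̃` with respect to `ν̃`;
it is finite by the square-integrability built into `MemClass`. Since the running times are bounded,
only finitely many pairs of particle numbers occur, so one constant serves for all of them. Both
recursions are thus instances of `MixingCocycle`.

For such a cocycle the starting point is felt only through its weight. Hence the masses started from
the reference measures are almost multiplicative along the shift (`mass_add_le`, `le_mass_add`), and
their logarithms are almost additive with a bounded first term. An almost additive sequence `f`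
satisfies `f n ≈ (1/k) ∑_{i<n} f k ∘ T^i` up to `n c / k + O(1)`. The ergodic theorem for the
bounded function `f k`, followed by `k → ∞`, then gives a deterministic rate
(`exists_ae_tendsto_of_almostAdditive`). Passing to another initial law `μ` with `μ(w) > 0` changes
the logarithm by a bounded amount.

Finally `Υ = Ξ - 2Λ` is read off from the quotient. It is nonnegative because the particle estimate
is unbiased, so that Jensen's inequality bounds its second moment below by the squared normalising
constant (`sq_normConst_le_secondMoment`). -/

namespace AliveFilter

/-! ### Pointwise ergodic theorem for bounded observables. -/

section Birkhoff

variable {Ω : Type*} {T : Ω → Ω}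

/-- The running maximum `max_{1 ≤ k ≤ n + 1} ∑_{i < k} g ∘ Tⁱ`. -/
noncomputable def birkhoffMax (T : Ω → Ω) (g : Ω → ℝ) : ℕ → Ω → ℝ
  | 0, x => g x
  | n + 1, x => g x + max 0 (birkhoffMax T g n (T x))

lemma birkhoffMax_le_succ (g : Ω → ℝ) (n : ℕ) (x : Ω) :
    birkhoffMax T g n x ≤ birkhoffMax T g (n + 1) x := by
  induction n generalizing x with
  | zero => simp [birkhoffMax]
  | succ n ih =>
    rw [birkhoffMax, birkhoffMax]
    gcongr
    exact ih _

lemma birkhoffMax_mono (g : Ω → ℝ) (x : Ω) : Monotone fun n => birkhoffMax T g n x :=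
  monotone_nat_of_le_succ fun n => birkhoffMax_le_succ g n x

lemma birkhoffSum_le_birkhoffMax (g : Ω → ℝ) (n : ℕ) (x : Ω) :
    birkhoffSum T g (n + 1) x ≤ birkhoffMax T g n x := by
  induction n generalizing x with
  | zero => simp [birkhoffMax]
  | succ n ih =>
    rw [birkhoffSum_succ', birkhoffMax]
    gcongr
    exact (ih _).trans (le_max_right _ _)

lemma abs_birkhoffMax_le {g : Ω → ℝ} {B : ℝ} (hB : ∀ x, |g x| ≤ B) (n : ℕ) (x : Ω) :
    |birkhoffMax T g n x| ≤ (n + 1) * B := by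
  induction n generalizing x with
  | zero => simpa [birkhoffMax] using hB x
  | succ n ih =>
    rw [birkhoffMax]
    have h1 := abs_le.1 (hB x)
    have h2 := abs_le.1 (ih (T x))
    have h0 : 0 ≤ B := (abs_nonneg _).trans (hB x)
    push_cast
    have h3 : max 0 (birkhoffMax T g n (T x)) ≤ (n + 1) * B :=
      max_le (by positivity) h2.2
    have h4 : 0 ≤ max 0 (birkhoffMax T g n (T x)) := le_max_left _ _
    have h5 : 0 ≤ ((n : ℝ) + 1) * B := by positivity
    rw [abs_le]
    constructor <;> linarith

variable [MeasurableSpace Ω] {P : Measure Ω}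

lemma measurable_birkhoffMax (hT : Measurable T) {g : Ω → ℝ} (hg : Measurable g) (n : ℕ) :
    Measurable (birkhoffMax T g n) := by
  induction n with
  | zero => exact hg
  | succ n ih => exact hg.add (measurable_const.max (ih.comp hT))

lemma integrable_birkhoffMax [IsFiniteMeasure P] (hT : Measurable T) {g : Ω → ℝ}
    (hg : Measurable g) {B : ℝ} (hB : ∀ x, |g x| ≤ B) (n : ℕ) :
    Integrable (birkhoffMax T g n) P :=
  Integrable.of_bound (measurable_birkhoffMax hT hg n).aestronglyMeasurable ((n + 1) * B)
    (ae_of_all _ fun x => by simpa using abs_birkhoffMax_le hB n x)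

/-- If `g` is bounded with negative mean, its Birkhoff sums along an ergodic map are almost surely
bounded above. -/
theorem ae_bddAbove_birkhoffMax [IsProbabilityMeasure P] (hT : Ergodic T P) {g : Ω → ℝ}
    (hg : Measurable g) {B : ℝ} (hB : ∀ x, |g x| ≤ B) (hneg : ∫ x, g x ∂P < 0) :
    ∀ᵐ x ∂P, BddAbove (Set.range fun n => birkhoffMax T g n x) := by
  have hTm : Measurable T := hT.measurable
  set A : Set Ω := {x | ¬ BddAbove (Set.range fun n => birkhoffMax T g n x)} with hA
  have hAm : MeasurableSet A :=
    (measurableSet_bddAbove_range fun n => measurable_birkhoffMax hTm hg n).compl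
  -- By the recursion, the maxima at `x` and at `T x` differ by bounded terms, so unboundedness is
  -- an invariant event and ergodicity gives it probability 0 or 1.
  have hinv : T ⁻¹' A = A := by
    ext x
    simp only [hA, Set.mem_preimage, Set.mem_ofPred_eq, not_iff_not]
    constructor
    · rintro ⟨b, hb⟩
      refine ⟨max (g x) (g x + max 0 b), ?_⟩
      rintro _ ⟨n, rfl⟩
      cases n with
      | zero => exact le_max_left _ _
      | succ n =>
        refine le_max_of_le_right ?_
        simp only [birkhoffMax]
        gcongr
        exact hb ⟨n, rfl⟩
    · rintro ⟨b, hb⟩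
      refine ⟨b - g x, ?_⟩
      rintro _ ⟨n, rfl⟩
      have := hb ⟨n + 1, rfl⟩
      simp only [birkhoffMax] at this
      have h2 := le_max_right 0 (birkhoffMax T g n (T x))
      linarith
  rcases hT.toPreErgodic.ae_empty_or_univ hAm hinv with h | h
  · filter_upwards [h] with x hx
    by_contra hcon
    have : (x ∈ A) = (x ∈ (∅ : Set Ω)) := hx
    have h3 : x ∈ A := hcon
    rw [this] at h3
    exact h3
  -- If the maxima `M_n` diverge almost surely, then `M_{n+1} - M_n ∘ T = g + max 0 (M_n ∘ T) - M_n
  -- ∘ T` is eventually `g`. Its integral is nonnegative by invariance and monotonicity in `n`, so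
  -- dominated convergence forces `∫ g ≥ 0`.
  · exfalso
    have hint := fun n => integrable_birkhoffMax (P := P) hTm hg hB n
    have hincr : ∀ n, 0 ≤ ∫ x, (birkhoffMax T g (n + 1) x - birkhoffMax T g n (T x)) ∂P := by
      intro n
      have hc : Integrable (fun x => birkhoffMax T g n (T x)) P :=
        (hT.toMeasurePreserving.integrable_comp (hint n).aestronglyMeasurable).2 (hint n)
      have he : ∫ x, birkhoffMax T g n (T x) ∂P = ∫ x, birkhoffMax T g n x ∂P := by
        conv_rhs => rw [← hT.toMeasurePreserving.map_eq]
        refine (integral_map hTm.aemeasurable ?_).symm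
        rw [hT.toMeasurePreserving.map_eq]
        exact (hint n).aestronglyMeasurable
      rw [integral_sub (hint _) hc, he, ← integral_sub (hint _) (hint _)]
      exact integral_nonneg fun x => sub_nonneg.2 (birkhoffMax_le_succ g n x)
    have hlim : Tendsto (fun n => ∫ x, (birkhoffMax T g (n + 1) x - birkhoffMax T g n (T x)) ∂P)
        atTop (𝓝 (∫ x, g x ∂P)) := by
      -- The difference is `g` plus the negative part of `M_n ∘ T`, and `M_n ≥ M_0 = g ≥ -B`; hence
      -- the bound `2 * B`.
      refine tendsto_integral_of_dominated_convergence (fun _ => 2 * B)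
        (fun n => ((measurable_birkhoffMax hTm hg (n + 1)).sub
          ((measurable_birkhoffMax hTm hg n).comp hTm)).aestronglyMeasurable)
        (integrable_const _) (fun n => ae_of_all _ fun x => ?_) ?_
      · simp only [birkhoffMax, Real.norm_eq_abs]
        have h1 := abs_le.1 (hB x)
        have h2 : -B ≤ birkhoffMax T g n (T x) :=
          (abs_le.1 (hB (T x))).1.trans (birkhoffMax_mono (T := T) g (T x) (Nat.zero_le n))
        rw [abs_le]
        rcases le_total 0 (birkhoffMax T g n (T x)) with h3 | h3
        · rw [max_eq_right h3]
          constructor <;> linarith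
        · rw [max_eq_left h3]
          constructor <;> linarith
      · filter_upwards [h] with x hx
        have hxA : T x ∈ A := by
          have : (x ∈ A) = (x ∈ (Set.univ : Set Ω)) := hx
          have h3 : x ∈ A := by rw [this]; trivial
          rw [← hinv] at h3
          exact h3
        have htop := tendsto_atTop_atTop_of_monotone' (birkhoffMax_mono (T := T) g (T x)) hxA
        refine tendsto_const_nhds.congr' ?_
        filter_upwards [htop.eventually_ge_atTop 0] with n hn
        simp [birkhoffMax, max_eq_right hn]
    exact absurd (ge_of_tendsto' hlim hincr) (not_le.2 hneg)

/-- Subtracting `∫ f + ε / 2` leaves a function of mean `-ε / 2`, whose Birkhoff sums are bounded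
above and hence at most `n ε / 2` eventually. -/
lemma ae_eventually_birkhoffAverage_lt [IsProbabilityMeasure P] (hT : Ergodic T P) {f : Ω → ℝ}
    (hf : Measurable f) {B : ℝ} (hB : ∀ x, |f x| ≤ B) {ε : ℝ} (hε : 0 < ε) :
    ∀ᵐ x ∂P, ∀ᶠ n : ℕ in atTop, birkhoffSum T f n x / n < ∫ y, f y ∂P + ε := by
  set c : ℝ := ∫ y, f y ∂P + ε / 2 with hc
  have hint : Integrable f P :=
    Integrable.of_bound hf.aestronglyMeasurable B (ae_of_all _ fun x => by simpa using hB x)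
  have := ae_bddAbove_birkhoffMax (P := P) hT (g := fun x => f x - c) (hf.sub_const c)
    (B := B + |c|) (fun x => (abs_sub _ _).trans (by gcongr; exact hB x))
    (by rw [integral_sub hint (integrable_const _)]; simp [hc]; linarith)
  filter_upwards [this] with x ⟨b, hb⟩
  have h1 : Tendsto (fun n : ℕ => b / n) atTop (𝓝 0) := tendsto_const_div_atTop_nhds_zero_nat b
  filter_upwards [h1.eventually_lt_const (half_pos hε), eventually_gt_atTop 0] with n hn hpos
  obtain ⟨k, rfl⟩ : ∃ k, n = k + 1 := ⟨n - 1, by omega⟩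
  have h2 := (birkhoffSum_le_birkhoffMax (T := T) (fun x => f x - c) k x).trans (hb ⟨k, rfl⟩)
  have h3 : birkhoffSum T (fun x => f x - c) (k + 1) x
      = birkhoffSum T f (k + 1) x - ((k + 1 : ℕ) : ℝ) * c := by
    simp [birkhoffSum, Finset.sum_sub_distrib]
  rw [h3] at h2
  have hp : (0 : ℝ) < ((k + 1 : ℕ) : ℝ) := by positivity
  rw [div_lt_iff₀ hp] at hn ⊢
  rw [hc] at h2
  nlinarith

/-- **Pointwise ergodic theorem** for bounded observables of an ergodic map. -/
theorem ae_tendsto_birkhoffSum_div [IsProbabilityMeasure P] (hT : Ergodic T P) {f : Ω → ℝ}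
    (hf : Measurable f) {B : ℝ} (hB : ∀ x, |f x| ≤ B) :
    ∀ᵐ x ∂P, Tendsto (fun n : ℕ => birkhoffSum T f n x / n) atTop (𝓝 (∫ y, f y ∂P)) := by
  have h1 : ∀ᵐ x ∂P, ∀ k : ℕ, ∀ᶠ n : ℕ in atTop,
      birkhoffSum T f n x / n < ∫ y, f y ∂P + 1 / ((k : ℝ) + 1) :=
    ae_all_iff.2 fun k => ae_eventually_birkhoffAverage_lt hT hf hB (by positivity)
  have h2 : ∀ᵐ x ∂P, ∀ k : ℕ, ∀ᶠ n : ℕ in atTop,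
      birkhoffSum T (fun x => - f x) n x / n < ∫ y, - f y ∂P + 1 / ((k : ℝ) + 1) :=
    ae_all_iff.2 fun k => ae_eventually_birkhoffAverage_lt hT hf.neg
      (fun x => by simpa using hB x) (by positivity)
  filter_upwards [h1, h2] with x hx1 hx2
  rw [Metric.tendsto_atTop']
  intro ε hε
  obtain ⟨k, hk⟩ := exists_nat_one_div_lt hε
  obtain ⟨N, hN⟩ := eventually_atTop.1 ((hx1 k).and (hx2 k))
  refine ⟨N, fun n hn => ?_⟩
  obtain ⟨h3, h4⟩ := hN n hn.le
  have h5 : birkhoffSum T (fun x => - f x) n x = - birkhoffSum T f n x := by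
    simp [birkhoffSum]
  rw [h5, integral_neg, neg_div] at h4
  rw [Real.dist_eq, abs_lt]
  constructor <;> linarith

end Birkhoff

/-! ### Almost additive sequences over an ergodic map. -/

section AlmostAdditive

variable {Ω : Type*} {T : Ω → Ω} {f : ℕ → Ω → ℝ} {c : ℝ}

lemma exists_bound_of_almostAdditive
    (hadd : ∀ n m ω, |f (n + m) ω - f n ω - f m (T^[n] ω)| ≤ c)
    (h1 : ∃ b, ∀ ω, |f 1 ω| ≤ b) (n : ℕ) : ∃ b, ∀ ω, |f n ω| ≤ b := by
  induction n with
  | zero =>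
    refine ⟨c, fun ω => ?_⟩
    simpa using hadd 0 0 ω
  | succ n ih =>
    obtain ⟨b, hb⟩ := ih
    obtain ⟨b₁, hb₁⟩ := h1
    refine ⟨c + b + b₁, fun ω => ?_⟩
    have h2 := abs_le.1 (hadd n 1 ω)
    have h3 := abs_le.1 (hb ω)
    have h4 := abs_le.1 (hb₁ (T^[n] ω))
    rw [abs_le]
    constructor <;> linarith

/-- Each `f k ∘ T^i` is within `c` of `f (i + k) - f i`. The sum of these over `i < n` telescopes to
`∑_{i<k} (f (n + i) - f i)`, in which every `f (n + i)` is `f n` up to a bound independent of `n`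
and `ω`. -/
lemma abs_mul_sub_birkhoffSum_le
    (hadd : ∀ n m ω, |f (n + m) ω - f n ω - f m (T^[n] ω)| ≤ c)
    (h1 : ∃ b, ∀ ω, |f 1 ω| ≤ b) (k : ℕ) :
    ∃ D, ∀ n ω, |k * f n ω - birkhoffSum T (f k) n ω| ≤ n * c + D := by
  choose b hb using exists_bound_of_almostAdditive hadd h1
  refine ⟨∑ i ∈ Finset.range k, (c + 2 * b i), fun n ω => ?_⟩
  have hswap : ∑ i ∈ Finset.range n, (f (i + k) ω - f i ω)
      = ∑ i ∈ Finset.range k, (f (n + i) ω - f i ω) := by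
    have e1 := Finset.sum_range_add (fun i => f i ω) n k
    have e2 := Finset.sum_range_add (fun i => f i ω) k n
    rw [add_comm k n] at e2
    simp only [Finset.sum_sub_distrib]
    simp only [add_comm k] at e2
    linarith
  have e3 : (k : ℝ) * f n ω - birkhoffSum T (f k) n ω
      = ∑ i ∈ Finset.range n, (f (i + k) ω - f i ω - f k (T^[i] ω))
        - ∑ i ∈ Finset.range k, (f (n + i) ω - f i ω - f n ω) := by
    have e4 : ∑ i ∈ Finset.range n, (f (i + k) ω - f i ω - f k (T^[i] ω))
        = ∑ i ∈ Finset.range n, (f (i + k) ω - f i ω) - birkhoffSum T (f k) n ω := by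
      rw [birkhoffSum, Finset.sum_sub_distrib (fun i => f (i + k) ω - f i ω)]
    rw [e4, hswap, Finset.sum_sub_distrib (fun i => f (n + i) ω - f i ω)]
    simp
  rw [e3]
  refine (abs_sub _ _).trans (add_le_add ?_ ?_)
  · refine (Finset.abs_sum_le_sum_abs _ _).trans
      ((Finset.sum_le_sum fun i _ => hadd i k ω).trans ?_)
    simp
  · refine (Finset.abs_sum_le_sum_abs _ _).trans (Finset.sum_le_sum fun i _ => ?_)
    have h2 := abs_le.1 (hadd n i ω)
    have h3 := abs_le.1 (hb i ω)
    have h4 := abs_le.1 (hb i (T^[n] ω))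
    rw [abs_le]
    constructor <;> linarith

/-- An almost additive sequence over an ergodic map, with bounded first term, grows linearly with a
deterministic rate. -/
theorem exists_ae_tendsto_of_almostAdditive [MeasurableSpace Ω] {P : Measure Ω}
    [IsProbabilityMeasure P] (hT : Ergodic T P) (hf : ∀ n, Measurable (f n))
    (hadd : ∀ n m ω, |f (n + m) ω - f n ω - f m (T^[n] ω)| ≤ c)
    (h1 : ∃ b, ∀ ω, |f 1 ω| ≤ b) :
    ∃ Λ : ℝ, ∀ᵐ ω ∂P, Tendsto (fun n : ℕ => f n ω / n) atTop (𝓝 Λ) := by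
  choose b hb using exists_bound_of_almostAdditive hadd h1
  set L : ℕ → ℝ := fun k => (∫ ω, f (k + 1) ω ∂P) / ((k + 1 : ℕ) : ℝ) with hL
  have hbirk : ∀ᵐ ω ∂P, ∀ k : ℕ, Tendsto (fun n : ℕ => birkhoffSum T (f (k + 1)) n ω / n) atTop
      (𝓝 (∫ y, f (k + 1) y ∂P)) :=
    ae_all_iff.2 fun k => ae_tendsto_birkhoffSum_div hT (hf _) (hb _)
  have hc : Tendsto (fun k : ℕ => c / ((k + 1 : ℕ) : ℝ)) atTop (𝓝 0) :=
    (tendsto_const_div_atTop_nhds_zero_nat c).comp (tendsto_add_atTop_nat 1)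
  -- The comparison with Birkhoff sums, divided by `(k + 1) n`, leaves the error `c / (k + 1)` in
  -- the limit; the index `k + 1` avoids division by zero.
  have hclose : ∀ᵐ ω ∂P, ∀ k : ℕ, ∀ ε > 0, ∀ᶠ n : ℕ in atTop,
      |f n ω / n - L k| ≤ c / ((k + 1 : ℕ) : ℝ) + ε := by
    filter_upwards [hbirk] with ω hω k ε hε
    obtain ⟨D, hD⟩ := abs_mul_sub_birkhoffSum_le hadd h1 (k + 1)
    have hk : (0 : ℝ) < ((k + 1 : ℕ) : ℝ) := by positivity
    have h2 : Tendsto (fun n : ℕ => c / ((k + 1 : ℕ) : ℝ) + D / ((k + 1 : ℕ) : ℝ) / n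
        + |birkhoffSum T (f (k + 1)) n ω / n / ((k + 1 : ℕ) : ℝ) - L k|) atTop
        (𝓝 (c / ((k + 1 : ℕ) : ℝ) + 0 + 0)) := by
      refine (tendsto_const_nhds.add (tendsto_const_div_atTop_nhds_zero_nat _)).add ?_
      have := (((hω k).div_const ((k + 1 : ℕ) : ℝ)).sub_const (L k)).abs
      simpa [hL] using this
    have h3 : c / ((k + 1 : ℕ) : ℝ) + 0 + 0 < c / ((k + 1 : ℕ) : ℝ) + ε := by linarith
    filter_upwards [h2.eventually_lt_const h3, eventually_gt_atTop 0] with n hn hpos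
    have hn0 : (0 : ℝ) < n := by exact_mod_cast hpos
    refine le_trans ?_ hn.le
    have h4 : f n ω / n - L k
        = (((k + 1 : ℕ) : ℝ) * f n ω - birkhoffSum T (f (k + 1)) n ω) / (((k + 1 : ℕ) : ℝ) * n)
          + (birkhoffSum T (f (k + 1)) n ω / n / ((k + 1 : ℕ) : ℝ) - L k) := by
      field_simp
      ring
    rw [h4]
    refine (abs_add_le _ _).trans (add_le_add ?_ le_rfl)
    rw [abs_div, abs_of_pos (mul_pos hk hn0), div_le_iff₀ (mul_pos hk hn0)]
    refine (hD n ω).trans (le_of_eq ?_)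
    field_simp
  -- The numbers `L j` and `L k` both approximate `f n ω / n` at one typical `ω`, so they are close
  -- to each other and no subadditivity argument is needed.
  have hLC : ∀ j k : ℕ, |L j - L k| ≤ c / ((j + 1 : ℕ) : ℝ) + c / ((k + 1 : ℕ) : ℝ) := by
    intro j k
    obtain ⟨ω, hω⟩ := hclose.exists
    refine le_of_forall_pos_le_add fun ε hε => ?_
    obtain ⟨n, hn1, hn2⟩ := ((hω j _ (half_pos hε)).and (hω k _ (half_pos hε))).exists
    have h5 := abs_le.1 hn1
    have h6 := abs_le.1 hn2
    rw [abs_le]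
    constructor <;> linarith
  have hcau : CauchySeq L := by
    rw [Metric.cauchySeq_iff']
    intro ε hε
    have hev := hc.eventually_lt_const (half_pos hε)
    obtain ⟨N, hN⟩ := eventually_atTop.1 hev
    refine ⟨N, fun n hn => ?_⟩
    rw [Real.dist_eq]
    exact (hLC n N).trans_lt (by linarith [hN n hn, hN N le_rfl])
  obtain ⟨Λ, hΛ⟩ := cauchySeq_tendsto_of_complete hcau
  refine ⟨Λ, ?_⟩
  filter_upwards [hclose] with ω hω
  rw [Metric.tendsto_atTop']
  intro ε hε
  have hε3 : 0 < ε / 3 := by positivity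
  have hdist := (hΛ.sub_const Λ).abs
  simp only [sub_self, abs_zero] at hdist
  obtain ⟨k, hk1, hk2⟩ :=
    ((hc.eventually_lt_const hε3).and (hdist.eventually_lt_const hε3)).exists
  obtain ⟨N, hN⟩ := eventually_atTop.1 (hω k _ (half_pos hε3))
  refine ⟨N, fun n hn => ?_⟩
  have h7 := abs_le.1 (hN n hn.le)
  have h8 := abs_lt.1 hk2
  rw [Real.dist_eq, abs_lt]
  constructor <;> linarith

end AlmostAdditive

end AliveFilter

/-! ### Mixing cocycles and their exponential growth rate. -/

namespace AliveFilter

/-- A cocycle of kernels `κ ω x` from `X ω` to `X (T ω)` that are comparable, with the uniform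
constant `C`, to `w ω x • η ω`, where the weights `w` are at most `1` and neither degenerate nor
explode under `η`; `F n ω` is the total mass of its `n`-fold composition. -/
structure MixingCocycle {Ω : Type*} (T : Ω → Ω) (X : Ω → Type*) [∀ ω, MeasurableSpace (X ω)]
    (κ : ∀ ω, X ω → Measure (X (T ω))) (F : ℕ → ∀ ω, X ω → ℝ≥0∞) (w : ∀ ω, X ω → ℝ≥0∞)
    (η : ∀ ω, Measure (X (T ω))) (C : ℝ≥0) : Prop where
  zero : ∀ ω x, F 0 ω x = 1
  succ : ∀ n ω x, F (n + 1) ω x = ∫⁻ y, F n (T ω) y ∂κ ω x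
  weight_le : ∀ ω x, w ω x ≤ 1
  lower : ∀ ω x, w ω x • η ω ≤ (C : ℝ≥0∞) • κ ω x
  upper : ∀ ω x, κ ω x ≤ ((C : ℝ≥0∞) * w ω x) • η ω
  mass_le : ∀ ω, η ω Set.univ ≤ C
  one_le : ∀ ω, 1 ≤ C * ∫⁻ y, w (T ω) y ∂η ω

namespace MixingCocycle

variable {Ω : Type*} {T : Ω → Ω} {X : Ω → Type*} [∀ ω, MeasurableSpace (X ω)]
  {κ : ∀ ω, X ω → Measure (X (T ω))} {F : ℕ → ∀ ω, X ω → ℝ≥0∞} {w : ∀ ω, X ω → ℝ≥0∞}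
  {η : ∀ ω, Measure (X (T ω))} {C : ℝ≥0}

/-- The mass of the `n`-fold composition started from `η ω`. -/
noncomputable def mass (T : Ω → Ω) (F : ℕ → ∀ ω, X ω → ℝ≥0∞) (η : ∀ ω, Measure (X (T ω)))
    (n : ℕ) (ω : Ω) : ℝ≥0∞ :=
  ∫⁻ y, F n (T ω) y ∂η ω

variable (h : MixingCocycle T X κ F w η C)
include h

/-- Together with `le_succ` this factorises the mass, up to `C`, into the weight of the starting
point and a quantity independent of it. -/
lemma succ_le (n : ℕ) (ω : Ω) (x : X ω) : F (n + 1) ω x ≤ C * w ω x * mass T F η n ω := by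
  rw [h.succ, mass, ← smul_eq_mul, ← lintegral_smul_measure]
  exact lintegral_mono' (h.upper ω x) le_rfl

lemma le_succ (n : ℕ) (ω : Ω) (x : X ω) : w ω x * mass T F η n ω ≤ C * F (n + 1) ω x := by
  rw [h.succ, mass, ← smul_eq_mul, ← smul_eq_mul, ← lintegral_smul_measure,
    ← lintegral_smul_measure]
  exact lintegral_mono' (h.lower ω x) le_rfl

lemma mass_zero (ω : Ω) : mass T F η 0 ω = η ω Set.univ := by
  simp [mass, h.zero]

lemma mass_zero_le (ω : Ω) : mass T F η 0 ω ≤ C := (h.mass_zero ω).trans_le (h.mass_le ω)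

lemma one_le_mass_zero (ω : Ω) : 1 ≤ C * mass T F η 0 ω := by
  refine (h.one_le ω).trans ?_
  gcongr
  rw [mass]
  gcongr with y
  rw [h.zero]
  exact h.weight_le _ y

lemma mass_succ_le (n : ℕ) (ω : Ω) :
    mass T F η (n + 1) ω ≤ C ^ 2 * mass T F η n (T ω) := by
  calc mass T F η (n + 1) ω ≤ ∫⁻ _, C * mass T F η n (T ω) ∂η ω := by
        rw [mass]
        refine lintegral_mono fun y => (h.succ_le n (T ω) y).trans ?_
        gcongr
        exact mul_le_of_le_one_right' (h.weight_le _ _)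
    _ ≤ C * mass T F η n (T ω) * C := by
        rw [lintegral_const]
        gcongr
        exact h.mass_le ω
    _ = C ^ 2 * mass T F η n (T ω) := by ring

lemma le_mass_succ (n : ℕ) (ω : Ω) :
    mass T F η n (T ω) ≤ C ^ 2 * mass T F η (n + 1) ω := by
  calc mass T F η n (T ω) ≤ (C * ∫⁻ y, w (T ω) y ∂η ω) * mass T F η n (T ω) :=
        le_mul_of_one_le_left' (h.one_le ω)
    _ = C * ((∫⁻ y, w (T ω) y ∂η ω) * mass T F η n (T ω)) := by ring
    _ ≤ C * ∫⁻ y, w (T ω) y * mass T F η n (T ω) ∂η ω := by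
        gcongr
        exact lintegral_mul_const_le _ _
    _ ≤ C * ∫⁻ y, C * F (n + 1) (T ω) y ∂η ω := by
        exact mul_le_mul' le_rfl (lintegral_mono fun y => h.le_succ n (T ω) y)
    _ = C ^ 2 * mass T F η (n + 1) ω := by
        rw [lintegral_const_mul' _ _ ENNReal.coe_ne_top, mass]
        ring

lemma mass_ne_top (n : ℕ) (ω : Ω) : mass T F η n ω ≠ ∞ := by
  induction n generalizing ω with
  | zero => exact ne_top_of_le_ne_top ENNReal.coe_ne_top (h.mass_zero_le ω)
  | succ n ih =>
    exact ne_top_of_le_ne_top (ENNReal.mul_ne_top (by simp) (ih _)) (h.mass_succ_le n ω)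

lemma mass_ne_zero (n : ℕ) (ω : Ω) : mass T F η n ω ≠ 0 := by
  induction n generalizing ω with
  | zero =>
    intro h0
    simpa [h0] using h.one_le_mass_zero ω
  | succ n ih =>
    intro h0
    have := h.le_mass_succ n ω
    rw [h0, mul_zero, nonpos_iff_eq_zero] at this
    exact ih _ this

/-- The constant does not grow with `n`: the comparison is made only in the base case, and the
induction merely integrates it against the preceding kernels. The three factors `C` come from
`succ_le`, `one_le_mass_zero` and `le_succ`. -/
lemma add_le (n m : ℕ) (ω : Ω) (x : X ω) :
    F (n + 1 + m) ω x ≤ C ^ 3 * mass T F η m (T^[n] ω) * F (n + 1) ω x := by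
  induction n generalizing ω with
  | zero =>
    calc F (0 + 1 + m) ω x = F (m + 1) ω x := by rw [zero_add, add_comm]
      _ ≤ C * w ω x * mass T F η m ω := h.succ_le m ω x
      _ ≤ C * w ω x * mass T F η m ω * (C * mass T F η 0 ω) :=
          le_mul_of_one_le_right' (h.one_le_mass_zero ω)
      _ = C ^ 2 * mass T F η m ω * (w ω x * mass T F η 0 ω) := by ring
      _ ≤ C ^ 2 * mass T F η m ω * (C * F (0 + 1) ω x) := by
          exact mul_le_mul' le_rfl (h.le_succ 0 ω x)
      _ = C ^ 3 * mass T F η m (T^[0] ω) * F (0 + 1) ω x := by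
          rw [Function.iterate_zero_apply]; ring
  | succ n ih =>
    rw [show n + 1 + 1 + m = (n + 1 + m) + 1 by omega, h.succ, h.succ (n + 1),
      ← lintegral_const_mul' _ _ (ENNReal.mul_ne_top (by simp) (h.mass_ne_top _ _))]
    exact lintegral_mono fun y => ih (T ω) y

lemma le_add (n m : ℕ) (ω : Ω) (x : X ω) :
    mass T F η m (T^[n] ω) * F (n + 1) ω x ≤ C ^ 3 * F (n + 1 + m) ω x := by
  induction n generalizing ω with
  | zero =>
    rw [Function.iterate_zero_apply]
    calc mass T F η m ω * F (0 + 1) ω x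
        ≤ mass T F η m ω * (C * w ω x * mass T F η 0 ω) := by
          gcongr
          exact h.succ_le 0 ω x
      _ ≤ mass T F η m ω * (C * w ω x * C) := by
          gcongr
          exact h.mass_zero_le ω
      _ = C ^ 2 * (w ω x * mass T F η m ω) := by ring
      _ ≤ C ^ 2 * (C * F (m + 1) ω x) := by
          exact mul_le_mul' le_rfl (h.le_succ m ω x)
      _ = C ^ 3 * F (0 + 1 + m) ω x := by
          rw [zero_add, add_comm 1 m]; ring
  | succ n ih =>
    rw [show n + 1 + 1 + m = (n + 1 + m) + 1 by omega, h.succ, h.succ (n + 1 + m),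
      ← lintegral_const_mul' _ _ (h.mass_ne_top _ _), ← lintegral_const_mul' _ _ (by simp)]
    exact lintegral_mono fun y => ih (T ω) y

/-- At any `ω` one has `1 ≤ C * mass ≤ C * C`. This lets smaller powers of `C` be absorbed into `C ^
3` below. -/
lemma one_le_const : (1 : ℝ≥0∞) ≤ C ∨ IsEmpty Ω := by
  rcases isEmpty_or_nonempty Ω with h0 | ⟨⟨ω⟩⟩
  · exact Or.inr h0
  · left
    by_contra hcon
    have h1 : (C : ℝ≥0∞) < 1 := not_le.1 hcon
    have h2 := h.one_le_mass_zero ω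
    have h3 : (C : ℝ≥0∞) * mass T F η 0 ω ≤ C * C := by gcongr; exact h.mass_zero_le ω
    have h4 : (C : ℝ≥0∞) * C ≤ C := mul_le_of_le_one_right' h1.le
    exact absurd (h2.trans (h3.trans h4)) (not_le.2 h1)

/-- For a positive first index this is `add_le` at `T ω`, integrated against `η ω`; the index 0
needs only that the initial mass is not small. -/
lemma mass_add_le (n m : ℕ) (ω : Ω) :
    mass T F η (n + m) ω ≤ C ^ 3 * (mass T F η n ω * mass T F η m (T^[n] ω)) := by
  have hC : (1 : ℝ≥0∞) ≤ C := h.one_le_const.resolve_right fun h0 => h0.elim ω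
  cases n with
  | zero =>
    rw [zero_add, Function.iterate_zero_apply]
    calc mass T F η m ω ≤ (C * mass T F η 0 ω) * mass T F η m ω :=
          le_mul_of_one_le_left' (h.one_le_mass_zero ω)
      _ ≤ C * C ^ 2 * (mass T F η 0 ω * mass T F η m ω) := by
          rw [mul_assoc, mul_assoc]
          exact mul_le_mul' le_rfl (le_mul_of_one_le_left' (one_le_pow₀ hC))
      _ = _ := by ring
  | succ n =>
    rw [mul_comm (mass T F η (n + 1) ω), ← mul_assoc, Function.iterate_succ_apply, mass,
      mass.eq_1 T F η (n + 1),
      ← lintegral_const_mul' _ _ (ENNReal.mul_ne_top (by simp) (h.mass_ne_top _ _))]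
    exact lintegral_mono fun y => h.add_le n m (T ω) y

lemma le_mass_add (n m : ℕ) (ω : Ω) :
    mass T F η n ω * mass T F η m (T^[n] ω) ≤ C ^ 3 * mass T F η (n + m) ω := by
  have hC : (1 : ℝ≥0∞) ≤ C := h.one_le_const.resolve_right fun h0 => h0.elim ω
  cases n with
  | zero =>
    rw [zero_add, Function.iterate_zero_apply]
    gcongr
    exact (h.mass_zero_le ω).trans (le_self_pow₀ hC (by norm_num))
  | succ n =>
    rw [mul_comm (mass T F η (n + 1) ω), Function.iterate_succ_apply, mass.eq_1 T F η (n + 1),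
      mass.eq_1 T F η (n + 1 + m),
      ← lintegral_const_mul' _ _ (h.mass_ne_top _ _), ← lintegral_const_mul' _ _ (by simp)]
    exact lintegral_mono fun y => h.le_add n m (T ω) y

end MixingCocycle

lemma abs_log_toReal_sub_le {a b : ℝ≥0∞} {C : ℝ≥0} (ha : a ≠ 0) (ha' : a ≠ ∞) (hb : b ≠ 0)
    (hb' : b ≠ ∞) (hab : a ≤ C * b) (hba : b ≤ C * a) :
    |Real.log a.toReal - Real.log b.toReal| ≤ Real.log C := by
  have pa := ENNReal.toReal_pos ha ha'
  have pb := ENNReal.toReal_pos hb hb'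
  have h1 := ENNReal.toReal_mono (ENNReal.mul_ne_top ENNReal.coe_ne_top hb') hab
  have h2 := ENNReal.toReal_mono (ENNReal.mul_ne_top ENNReal.coe_ne_top ha') hba
  rw [ENNReal.toReal_mul, ENNReal.coe_toReal] at h1 h2
  have pC : (0 : ℝ) < C := by
    by_contra hcon
    have : (C : ℝ) = 0 := le_antisymm (not_lt.1 hcon) C.coe_nonneg
    rw [this, zero_mul] at h1
    linarith
  have h3 := Real.log_le_log pa h1
  have h4 := Real.log_le_log pb h2
  rw [Real.log_mul pC.ne' pb.ne'] at h3
  rw [Real.log_mul pC.ne' pa.ne'] at h4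
  rw [abs_le]
  constructor <;> linarith

namespace MixingCocycle

variable {Ω : Type*} {T : Ω → Ω} {X : Ω → Type*} [∀ ω, MeasurableSpace (X ω)]
  {κ : ∀ ω, X ω → Measure (X (T ω))} {F : ℕ → ∀ ω, X ω → ℝ≥0∞} {w : ∀ ω, X ω → ℝ≥0∞}
  {η : ∀ ω, Measure (X (T ω))} {C : ℝ≥0}

/-- Transfer of the growth rate from the reference measures to an arbitrary initial law that
charges the weight. -/
lemma hasExponent_of_tendsto (h : MixingCocycle T X κ F w η C) {Λ : ℝ} {ω : Ω}
    (hω : Tendsto (fun n : ℕ => Real.log (mass T F η n ω).toReal / n) atTop (𝓝 Λ))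
    (μ : Measure (X ω)) [IsProbabilityMeasure μ] (hμ : ∫⁻ x, w ω x ∂μ ≠ 0) :
    HasExponent (fun n => ∫⁻ x, F n ω x ∂μ) Λ := by
  set W := ∫⁻ x, w ω x ∂μ with hW
  have hW1 : W ≠ ∞ := by
    refine ne_top_of_le_ne_top ENNReal.one_ne_top ?_
    calc W ≤ ∫⁻ _, 1 ∂μ := lintegral_mono fun x => h.weight_le ω x
      _ = 1 := by simp
  have hup : ∀ n, ∫⁻ x, F (n + 1) ω x ∂μ ≤ C * (W * mass T F η n ω) := by
    intro n
    calc ∫⁻ x, F (n + 1) ω x ∂μ ≤ ∫⁻ x, (C * mass T F η n ω) * w ω x ∂μ :=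
          lintegral_mono fun x => (h.succ_le n ω x).trans (le_of_eq (by ring))
      _ = C * (W * mass T F η n ω) := by
          rw [lintegral_const_mul' _ _ (ENNReal.mul_ne_top ENNReal.coe_ne_top (h.mass_ne_top _ _))]
          ring
  have hlo : ∀ n, W * mass T F η n ω ≤ C * ∫⁻ x, F (n + 1) ω x ∂μ := by
    intro n
    rw [hW, ← lintegral_mul_const' _ _ (h.mass_ne_top _ _),
      ← lintegral_const_mul' _ _ ENNReal.coe_ne_top]
    exact lintegral_mono fun x => h.le_succ n ω x
  have hp0 : ∀ n, W * mass T F η n ω ≠ 0 := fun n => mul_ne_zero hμ (h.mass_ne_zero n ω)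
  have hp1 : ∀ n, W * mass T F η n ω ≠ ∞ := fun n => ENNReal.mul_ne_top hW1 (h.mass_ne_top n ω)
  have hpos : ∀ n, ∫⁻ x, F n ω x ∂μ ≠ 0 ∧ ∫⁻ x, F n ω x ∂μ ≠ ∞ := by
    intro n
    cases n with
    | zero => simp [h.zero]
    | succ n =>
      refine ⟨fun h0 => ?_, ne_top_of_le_ne_top (ENNReal.mul_ne_top ENNReal.coe_ne_top (hp1 n))
        (hup n)⟩
      have := hlo n
      rw [h0, mul_zero, nonpos_iff_eq_zero] at this
      exact hp0 n this
  refine ⟨hpos, ?_⟩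
  -- Integration against `μ` links `F (n + 1)` with the mass of index `n`. Hence the shift of index,
  -- the factor `n / (n + 1)`, and an error of `log C + |log W|` over `n + 1`.
  rw [← tendsto_add_atTop_iff_nat 1]
  have hratio : Tendsto (fun n : ℕ => (n : ℝ) / ((n : ℝ) + 1)) atTop (𝓝 1) :=
    tendsto_natCast_div_add_atTop 1
  have hmain : Tendsto (fun n : ℕ => Real.log (mass T F η n ω).toReal / n
      * ((n : ℝ) / ((n : ℝ) + 1))) atTop (𝓝 Λ) := by simpa using hω.mul hratio
  have herr : Tendsto (fun n : ℕ => (Real.log (∫⁻ x, F (n + 1) ω x ∂μ).toReal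
      - Real.log (mass T F η n ω).toReal) / ((n + 1 : ℕ) : ℝ)) atTop (𝓝 0) := by
    have hb : Tendsto (fun n : ℕ => (Real.log C + |Real.log W.toReal|) / ((n + 1 : ℕ) : ℝ)) atTop
        (𝓝 0) := (tendsto_const_div_atTop_nhds_zero_nat _).comp (tendsto_add_atTop_nat 1)
    refine squeeze_zero_norm (fun n => ?_) hb
    rw [Real.norm_eq_abs, abs_div, Nat.abs_cast]
    gcongr
    have h1 := abs_log_toReal_sub_le (hpos (n + 1)).1 (hpos (n + 1)).2 (hp0 n) (hp1 n) (hup n)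
      (hlo n)
    rw [ENNReal.toReal_mul, Real.log_mul (ENNReal.toReal_pos hμ hW1).ne'
      (ENNReal.toReal_pos (h.mass_ne_zero n ω) (h.mass_ne_top n ω)).ne'] at h1
    have h2 := abs_add_le (Real.log (∫⁻ x, F (n + 1) ω x ∂μ).toReal
      - (Real.log W.toReal + Real.log (mass T F η n ω).toReal)) (Real.log W.toReal)
    refine le_trans (le_of_eq ?_) (h2.trans (by gcongr))
    congr 1
    ring
  have := hmain.add herr
  rw [add_zero] at this
  refine this.congr' ?_
  filter_upwards [eventually_gt_atTop 0] with n hn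
  have hn0 : (n : ℝ) ≠ 0 := by exact_mod_cast hn.ne'
  push_cast
  field_simp
  ring

/-- The masses of a mixing cocycle over an ergodic map have a deterministic exponential growth
rate, common to all initial laws that charge the weight. -/
theorem exists_hasExponent [MeasurableSpace Ω] {P : Measure Ω} [IsProbabilityMeasure P]
    (h : MixingCocycle T X κ F w η C) (hT : Ergodic T P)
    (hm : ∀ n, Measurable (mass T F η n)) :
    ∃ Λ : ℝ, ∀ᵐ ω ∂P, ∀ μ : Measure (X ω), IsProbabilityMeasure μ → ∫⁻ x, w ω x ∂μ ≠ 0 →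
      HasExponent (fun n => ∫⁻ x, F n ω x ∂μ) Λ := by
  have hadd : ∀ n m ω, |Real.log (mass T F η (n + m) ω).toReal
      - Real.log (mass T F η n ω).toReal - Real.log (mass T F η m (T^[n] ω)).toReal|
      ≤ Real.log ((C ^ 3 : ℝ≥0) : ℝ) := by
    intro n m ω
    have h1 := abs_log_toReal_sub_le (C := C ^ 3) (h.mass_ne_zero (n + m) ω)
      (h.mass_ne_top (n + m) ω)
      (mul_ne_zero (h.mass_ne_zero n ω) (h.mass_ne_zero m (T^[n] ω)))
      (ENNReal.mul_ne_top (h.mass_ne_top n ω) (h.mass_ne_top m (T^[n] ω)))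
      (by simpa using h.mass_add_le n m ω) (by simpa using h.le_mass_add n m ω)
    rwa [ENNReal.toReal_mul, Real.log_mul
      (ENNReal.toReal_pos (h.mass_ne_zero n ω) (h.mass_ne_top n ω)).ne'
      (ENNReal.toReal_pos (h.mass_ne_zero m _) (h.mass_ne_top m _)).ne', ← sub_sub] at h1
  have hzero : ∀ ω, |Real.log (mass T F η 0 ω).toReal| ≤ Real.log C := by
    intro ω
    have h1 := abs_log_toReal_sub_le (C := C) (h.mass_ne_zero 0 ω) (h.mass_ne_top 0 ω)
      one_ne_zero ENNReal.one_ne_top (by simpa using h.mass_zero_le ω) (h.one_le_mass_zero ω)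
    simpa using h1
  -- The mass of index 1 is comparable to that of index 0 at `T ω`, which lies between `C⁻¹` and
  -- `C`.
  have hone : ∃ b, ∀ ω, |Real.log (mass T F η 1 ω).toReal| ≤ b := by
    refine ⟨Real.log ((C ^ 2 : ℝ≥0) : ℝ) + Real.log C, fun ω => ?_⟩
    have h1 := abs_log_toReal_sub_le (C := C ^ 2) (h.mass_ne_zero 1 ω) (h.mass_ne_top 1 ω)
      (h.mass_ne_zero 0 (T ω)) (h.mass_ne_top 0 (T ω)) (by simpa using h.mass_succ_le 0 ω)
      (by simpa using h.le_mass_succ 0 ω)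
    have h2 := abs_add_le (Real.log (mass T F η 1 ω).toReal
      - Real.log (mass T F η 0 (T ω)).toReal) (Real.log (mass T F η 0 (T ω)).toReal)
    rw [sub_add_cancel] at h2
    exact h2.trans (add_le_add h1 (hzero _))
  obtain ⟨Λ, hΛ⟩ := exists_ae_tendsto_of_almostAdditive (P := P)
    (f := fun n ω => Real.log (mass T F η n ω).toReal) hT
    (fun n => Real.measurable_log.comp (hm n).ennreal_toReal) hadd hone
  refine ⟨Λ, ?_⟩
  filter_upwards [hΛ] with ω hω μ _ hμ
  exact h.hasExponent_of_tendsto hω μ hμ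

end MixingCocycle

end AliveFilter

/-! ### Jensen's inequality, product measures and squared densities. -/

namespace AliveFilter

lemma ennreal_two_mul_le_add_sq (a b : ℝ≥0∞) : 2 * a * b ≤ a ^ 2 + b ^ 2 := by
  rcases eq_or_ne a ∞ with rfl | ha
  · simp
  rcases eq_or_ne b ∞ with rfl | hb
  · simp
  lift a to ℝ≥0 using ha
  lift b to ℝ≥0 using hb
  exact_mod_cast two_mul_le_add_sq a b

/-- Jensen's inequality for the square, without measurability assumption. -/
lemma sq_lintegral_le {α : Type*} [MeasurableSpace α] (μ : Measure α) [IsProbabilityMeasure μ]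
    (f : α → ℝ≥0∞) : (∫⁻ x, f x ∂μ) ^ 2 ≤ ∫⁻ x, f x ^ 2 ∂μ := by
  set c := ∫⁻ x, f x ∂μ with hc
  -- This is `∫ (f - a)² ≥ 0` written without subtraction. The choice `a = c` gives the claim if `c`
  -- is finite, and `a = 1` makes the right side infinite otherwise.
  have key : ∀ a : ℝ≥0∞, a ≠ ∞ → 2 * a * c ≤ ∫⁻ x, f x ^ 2 ∂μ + a ^ 2 := by
    intro a ha
    calc 2 * a * c = ∫⁻ x, 2 * a * f x ∂μ := by
          rw [lintegral_const_mul' _ _ (ENNReal.mul_ne_top (by simp) ha)]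
      _ ≤ ∫⁻ x, (f x ^ 2 + a ^ 2) ∂μ := lintegral_mono fun x => by
          rw [add_comm]; exact ennreal_two_mul_le_add_sq a (f x)
      _ = ∫⁻ x, f x ^ 2 ∂μ + a ^ 2 := by
          rw [lintegral_add_right _ measurable_const]; simp
  rcases eq_or_ne c ∞ with h | h
  · have := key 1 ENNReal.one_ne_top
    rw [h] at this
    have h2 : ∫⁻ x, f x ^ 2 ∂μ = ∞ := by simpa using this
    rw [h2]
    exact le_top
  · have := key c h
    rw [show 2 * c * c = c ^ 2 + c ^ 2 by ring] at this
    exact (ENNReal.add_le_add_iff_right (ENNReal.pow_ne_top h)).1 this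

section Pi

variable {ι β : Type*} [Fintype ι] [MeasurableSpace β]

/-- The product outer measure is the largest one dominated by the products of the factors on boxes,
hence monotone in the factors. -/
lemma measure_pi_mono {μ ν : ι → Measure β} (h : ∀ i, μ i ≤ ν i) :
    Measure.pi μ ≤ Measure.pi ν := by
  rw [Measure.le_iff]
  intro s hs
  rw [Measure.pi, Measure.pi, toMeasure_apply _ _ hs, toMeasure_apply _ _ hs]
  have : (OuterMeasure.pi fun i => (μ i).toOuterMeasure)
      ≤ OuterMeasure.pi fun i => (ν i).toOuterMeasure := by
    rw [OuterMeasure.le_pi]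
    intro t _
    exact (OuterMeasure.pi_pi_le _ t).trans (Finset.prod_le_prod' fun i _ => h i (t i))
  exact this s

lemma measure_pi_smul (c : ℝ≥0) (ν : Measure β) [IsProbabilityMeasure ν] :
    Measure.pi (fun _ : ι => c • ν) = c ^ Fintype.card ι • Measure.pi (fun _ : ι => ν) := by
  refine Measure.pi_eq fun s _ => ?_
  rw [Measure.smul_apply, Measure.pi_pi]
  simp only [Measure.smul_apply, ENNReal.smul_def, smul_eq_mul, Finset.prod_mul_distrib,
    Finset.prod_const, Finset.card_univ, ENNReal.coe_pow]

lemma measurable_measure_pi {α : Type*} [MeasurableSpace α] {μ : α → Measure β}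
    [∀ a, IsFiniteMeasure (μ a)] (hμ : Measurable μ) :
    Measurable fun a => Measure.pi (fun _ : ι => μ a) := by
  refine Measurable.measure_of_isPiSystem generateFrom_pi.symm isPiSystem_pi ?_ ?_
  · rintro _ ⟨s, hs, rfl⟩
    simp only [Measure.pi_pi]
    refine Finset.measurable_prod _ fun i _ => ?_
    exact (Measure.measurable_coe (hs i (Set.mem_univ i))).comp hμ
  · simp only [Measure.pi_univ]
    refine Finset.measurable_prod _ fun i _ => ?_
    exact (Measure.measurable_coe MeasurableSet.univ).comp hμ

lemma lintegral_pi_eval (μ : Measure β) [IsProbabilityMeasure μ] {f : β → ℝ≥0∞}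
    (hf : Measurable f) (i : ι) :
    ∫⁻ y, f (y i) ∂Measure.pi (fun _ : ι => μ) = ∫⁻ x, f x ∂μ :=
  (measurePreserving_eval (fun _ : ι => μ) i).lintegral_comp hf

end Pi

section Density

variable {Y : Type*} [MeasurableSpace Y] {b κ νt π : Measure Y} {a₁ a₂ t₁ t₂ : ℝ≥0}
  [IsFiniteMeasure b] [IsFiniteMeasure κ] [IsFiniteMeasure νt] [IsFiniteMeasure π]

/-- Over any set `s`, replacing `κ` by `t₂ • νt` bounds the left integral by `t₂ a₁ π(s) ≤ t₂ b(s)`,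
which is the right integral. -/
lemma mul_rnDeriv_le_mul_rnDeriv (hb : a₁ • π ≤ b) (hκ : κ ≤ t₂ • νt) (hπ : π ≪ νt)
    (hbκ : b ≪ κ) :
    ∀ᵐ y ∂κ, (a₁ : ℝ≥0∞) * π.rnDeriv νt y ≤ t₂ * b.rnDeriv κ y := by
  refine ae_le_of_forall_setLIntegral_le_of_sigmaFinite
    ((Measure.measurable_rnDeriv _ _).const_mul _) fun s hs _ => ?_
  calc ∫⁻ y in s, (a₁ : ℝ≥0∞) * π.rnDeriv νt y ∂κ
      ≤ ∫⁻ y in s, (a₁ : ℝ≥0∞) * π.rnDeriv νt y ∂(t₂ • νt) :=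
        lintegral_mono' (Measure.restrict_mono le_rfl hκ) le_rfl
    _ = t₂ * (a₁ * π s) := by
        rw [Measure.restrict_smul, lintegral_smul_measure,
          lintegral_const_mul _ (Measure.measurable_rnDeriv _ _),
          Measure.setLIntegral_rnDeriv hπ, ENNReal.smul_def, smul_eq_mul]
    _ ≤ t₂ * b s := by
        refine mul_le_mul' le_rfl ?_
        have := hb s
        rwa [Measure.smul_apply, ENNReal.smul_def, smul_eq_mul] at this
    _ = ∫⁻ y in s, t₂ * b.rnDeriv κ y ∂κ := by
        rw [lintegral_const_mul _ (Measure.measurable_rnDeriv _ _),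
          Measure.setLIntegral_rnDeriv hbκ]

/-- Comparison of the second-moment measure `(db/dκ)² κ` with the reference measure
`(dπ/dνt)² νt`, from below. -/
lemma smul_withDensity_sq_le (hb : a₁ • π ≤ b) (hκ₁ : t₁ • νt ≤ κ) (hκ : κ ≤ t₂ • νt)
    (hπ : π ≪ νt) (hbκ : b ≪ κ) :
    (t₁ * a₁ ^ 2) • νt.withDensity (fun y => π.rnDeriv νt y ^ 2)
      ≤ t₂ ^ 2 • κ.withDensity (fun y => b.rnDeriv κ y ^ 2) := by
  rw [Measure.le_iff]
  intro s hs
  simp only [Measure.smul_apply, ENNReal.smul_def, smul_eq_mul, withDensity_apply _ hs]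
  push_cast
  -- Exchanging the base measure costs `t₁` once, while the comparison of densities is squared and
  -- accounts for `a₁ ^ 2` and `t₂ ^ 2`.
  calc (t₁ : ℝ≥0∞) * a₁ ^ 2 * ∫⁻ y in s, π.rnDeriv νt y ^ 2 ∂νt
      = a₁ ^ 2 * ∫⁻ y in s, π.rnDeriv νt y ^ 2 ∂(t₁ • νt) := by
        rw [Measure.restrict_smul, lintegral_smul_measure, ENNReal.smul_def, smul_eq_mul]
        ring
    _ ≤ a₁ ^ 2 * ∫⁻ y in s, π.rnDeriv νt y ^ 2 ∂κ :=
        mul_le_mul' le_rfl (lintegral_mono' (Measure.restrict_mono le_rfl hκ₁) le_rfl)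
    _ = ∫⁻ y in s, (a₁ * π.rnDeriv νt y) ^ 2 ∂κ := by
        rw [← lintegral_const_mul' _ _ (by simp)]
        simp only [mul_pow]
    _ ≤ ∫⁻ y in s, (t₂ * b.rnDeriv κ y) ^ 2 ∂κ := by
        refine lintegral_mono_ae (ae_restrict_of_ae ?_)
        filter_upwards [mul_rnDeriv_le_mul_rnDeriv hb hκ hπ hbκ] with y hy
        gcongr
    _ = t₂ ^ 2 * ∫⁻ y in s, b.rnDeriv κ y ^ 2 ∂κ := by
        rw [← lintegral_const_mul' _ _ (by simp)]
        simp only [mul_pow]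

/-- Comparison of the second-moment measure `(db/dκ)² κ` with the reference measure
`(dπ/dνt)² νt`, from above. -/
lemma withDensity_sq_le_smul (hb : b ≤ a₂ • π) (hκ₁ : t₁ • νt ≤ κ) (hκ : κ ≤ t₂ • νt)
    (hπ : π ≪ νt) (hbκ : b ≪ κ) :
    t₁ ^ 2 • κ.withDensity (fun y => b.rnDeriv κ y ^ 2)
      ≤ (t₂ * a₂ ^ 2) • νt.withDensity (fun y => π.rnDeriv νt y ^ 2) := by
  have hae : ∀ᵐ y ∂κ, (t₁ : ℝ≥0∞) * b.rnDeriv κ y ≤ a₂ * π.rnDeriv νt y := by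
    refine ae_le_of_forall_setLIntegral_le_of_sigmaFinite
      ((Measure.measurable_rnDeriv _ _).const_mul _) fun s hs _ => ?_
    calc ∫⁻ y in s, (t₁ : ℝ≥0∞) * b.rnDeriv κ y ∂κ = t₁ * b s := by
          rw [lintegral_const_mul _ (Measure.measurable_rnDeriv _ _),
            Measure.setLIntegral_rnDeriv hbκ]
      _ ≤ t₁ * (a₂ * π s) := by
          refine mul_le_mul' le_rfl ?_
          have := hb s
          rwa [Measure.smul_apply, ENNReal.smul_def, smul_eq_mul] at this
      _ = ∫⁻ y in s, (a₂ : ℝ≥0∞) * π.rnDeriv νt y ∂(t₁ • νt) := by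
          rw [Measure.restrict_smul, lintegral_smul_measure,
            lintegral_const_mul _ (Measure.measurable_rnDeriv _ _),
            Measure.setLIntegral_rnDeriv hπ, ENNReal.smul_def, smul_eq_mul]
      _ ≤ ∫⁻ y in s, (a₂ : ℝ≥0∞) * π.rnDeriv νt y ∂κ :=
          lintegral_mono' (Measure.restrict_mono le_rfl hκ₁) le_rfl
  rw [Measure.le_iff]
  intro s hs
  simp only [Measure.smul_apply, ENNReal.smul_def, smul_eq_mul, withDensity_apply _ hs]
  push_cast
  calc (t₁ : ℝ≥0∞) ^ 2 * ∫⁻ y in s, b.rnDeriv κ y ^ 2 ∂κ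
      = ∫⁻ y in s, (t₁ * b.rnDeriv κ y) ^ 2 ∂κ := by
        rw [← lintegral_const_mul' _ _ (by simp)]
        simp only [mul_pow]
    _ ≤ ∫⁻ y in s, (a₂ * π.rnDeriv νt y) ^ 2 ∂κ := by
        refine lintegral_mono_ae (ae_restrict_of_ae ?_)
        filter_upwards [hae] with y hy
        gcongr
    _ = a₂ ^ 2 * ∫⁻ y in s, π.rnDeriv νt y ^ 2 ∂κ := by
        rw [← lintegral_const_mul' _ _ (by simp)]
        simp only [mul_pow]
    _ ≤ a₂ ^ 2 * ∫⁻ y in s, π.rnDeriv νt y ^ 2 ∂(t₂ • νt) :=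
        mul_le_mul' le_rfl (lintegral_mono' (Measure.restrict_mono le_rfl hκ) le_rfl)
    _ = (t₂ : ℝ≥0∞) * a₂ ^ 2 * ∫⁻ y in s, π.rnDeriv νt y ^ 2 ∂νt := by
        rw [Measure.restrict_smul, lintegral_smul_measure, ENNReal.smul_def, smul_eq_mul]
        ring

end Density

end AliveFilter

/-! ### Weights, the selection-mutation law and measurability. -/

namespace AliveFilter

variable {S H : Type*} [MeasurableSpace S] [MeasurableSpace H] [MetricSpace H]

lemma weight_le_one (A : Model S H) (ω : ℤ → H) (x : S × H) : weight A ω x ≤ 1 :=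
  Set.indicator_le_self' (fun _ _ => zero_le) x

lemma avgWeight_le_one (A : Model S H) {m : ℕ} (ω : ℤ → H) (x : Fin m → S × H) :
    avgWeight A ω x ≤ 1 := by
  calc avgWeight A ω x ≤ (m : ℝ≥0∞)⁻¹ * ∑ _j : Fin m, 1 := by
        unfold avgWeight
        gcongr
        exact weight_le_one A ω _
    _ = (m : ℝ≥0∞)⁻¹ * m := by simp
    _ ≤ 1 := ENNReal.inv_mul_le_one _

lemma avgWeight_ne_top (A : Model S H) {m : ℕ} (ω : ℤ → H) (x : Fin m → S × H) :
    avgWeight A ω x ≠ ∞ :=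
  ne_top_of_le_ne_top ENNReal.one_ne_top (avgWeight_le_one A ω x)

lemma lintegral_average {E : Type*} [MeasurableSpace E] (μ : Measure E) [IsProbabilityMeasure μ]
    {f : E → ℝ≥0∞} (hf : Measurable f) {m : ℕ} (hm : m ≠ 0) :
    ∫⁻ y, (m : ℝ≥0∞)⁻¹ * ∑ j, f (y j) ∂Measure.pi (fun _ : Fin m => μ) = ∫⁻ x, f x ∂μ := by
  have hj : ∀ j : Fin m, Measurable fun y : Fin m → E => f (y j) :=
    fun j => hf.comp (measurable_pi_apply j)
  rw [lintegral_const_mul _ (Finset.measurable_sum _ fun j _ => hj j),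
    lintegral_finsetSum _ fun j _ => hj j]
  simp only [lintegral_pi_eval μ hf, Finset.sum_const, Finset.card_univ, Fintype.card_fin,
    nsmul_eq_mul]
  rw [← mul_assoc, ENNReal.inv_mul_cancel (by exact_mod_cast hm) (ENNReal.natCast_ne_top m),
    one_mul]

section Selection

variable (A : Model S H) {m : ℕ} (ω : ℤ → H) (x : Fin m → S × H)

lemma selMut_apply (s : Set (S × H)) :
    selMut A ω x s = (avgWeight A ω x)⁻¹
      * ((m : ℝ≥0∞)⁻¹ * ∑ j, weight A ω (x j) * A.M (ω, x j) s) := by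
  simp [selMut, Measure.smul_apply, Measure.finsetSum_apply]

lemma lintegral_selMut (f : S × H → ℝ≥0∞) :
    ∫⁻ y, f y ∂selMut A ω x = (avgWeight A ω x)⁻¹
      * ((m : ℝ≥0∞)⁻¹ * ∑ j, weight A ω (x j) * ∫⁻ y, f y ∂A.M (ω, x j)) := by
  simp [selMut, lintegral_smul_measure, lintegral_finsetSum_measure]

/-- The product is left uncancelled since it equals `∞ * 0 = 0` when all weights vanish, and 1
otherwise. -/
lemma selMut_univ : selMut A ω x Set.univ = (avgWeight A ω x)⁻¹ * avgWeight A ω x := by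
  have := A.markov_M
  rw [selMut_apply, avgWeight]
  simp

instance : IsFiniteMeasure (selMut A ω x) := by
  refine ⟨?_⟩
  rw [selMut_univ]
  exact (ENNReal.inv_mul_le_one _).trans_lt ENNReal.one_lt_top

variable {A ω x}

lemma isProbabilityMeasure_selMut (h : avgWeight A ω x ≠ 0) :
    IsProbabilityMeasure (selMut A ω x) :=
  ⟨by rw [selMut_univ, ENNReal.inv_mul_cancel h (avgWeight_ne_top A ω x)]⟩

lemma smul_le_selMut {ν : Measure (S × H)} {e₁ : ℝ≥0} (he : ∀ x, e₁ • ν ≤ A.M (ω, x))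
    (h : avgWeight A ω x ≠ 0) : e₁ • ν ≤ selMut A ω x := by
  intro s
  rw [selMut_apply]
  calc (e₁ • ν) s = ((avgWeight A ω x)⁻¹ * avgWeight A ω x) * (e₁ • ν) s := by
        rw [ENNReal.inv_mul_cancel h (avgWeight_ne_top A ω x), one_mul]
    _ = (avgWeight A ω x)⁻¹ * ((m : ℝ≥0∞)⁻¹ * ∑ j, weight A ω (x j) * (e₁ • ν) s) := by
        rw [avgWeight, ← Finset.sum_mul]
        ring
    _ ≤ _ := by
        gcongr with j
        exact he _

lemma selMut_le_smul {ν : Measure (S × H)} {e₂ : ℝ≥0} (he : ∀ x, A.M (ω, x) ≤ e₂ • ν)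
    (h : avgWeight A ω x ≠ 0) : selMut A ω x ≤ e₂ • ν := by
  intro s
  rw [selMut_apply]
  calc _ ≤ (avgWeight A ω x)⁻¹ * ((m : ℝ≥0∞)⁻¹ * ∑ j, weight A ω (x j) * (e₂ • ν) s) := by
        gcongr with j
        exact he _
    _ = ((avgWeight A ω x)⁻¹ * avgWeight A ω x) * (e₂ • ν) s := by
        rw [avgWeight, ← Finset.sum_mul]
        ring
    _ = _ := by rw [ENNReal.inv_mul_cancel h (avgWeight_ne_top A ω x), one_mul]

instance (m₂ : ℕ) : IsFiniteMeasure (bigM A m₂ ω x) := by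
  unfold bigM
  infer_instance

lemma measurable_phi (K : Proposal S H) {m₂ : ℕ} :
    Measurable (phi A K ω x : (Fin m₂ → S × H) → ℝ≥0∞) :=
  Measure.measurable_rnDeriv _ _

lemma bigR_eq_smul (K : Proposal S H) (m₂ : ℕ) :
    bigR A K m₂ ω x = avgWeight A ω x ^ 2
      • (K m m₂ (ω, x)).withDensity (fun y => phi A K ω x y ^ 2) := by
  rw [← withDensity_smul _ ((measurable_phi K).pow_const 2)]
  rfl

end Selection

section Measurability

variable [SecondCountableTopology H] [BorelSpace H]

omit [MetricSpace H] [SecondCountableTopology H] [BorelSpace H] in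
lemma measurable_shift : Measurable (shift : (ℤ → H) → ℤ → H) :=
  measurable_pi_lambda _ fun n => measurable_pi_apply (n + 1)

lemma measurable_weight_uncurry (A : Model S H) :
    Measurable fun p : (ℤ → H) × (S × H) => weight A p.1 p.2 := by
  have hs : MeasurableSet {p : (ℤ → H) × (S × H) | dist p.2.2 (p.1 1) < A.radius p.1} := by
    refine measurableSet_lt ?_ (A.measurable_radius.comp measurable_fst)
    exact (measurable_snd.comp measurable_snd).dist
      ((measurable_pi_apply (1 : ℤ)).comp measurable_fst)
  exact measurable_const.indicator hs

lemma measurable_weight (A : Model S H) (ω : ℤ → H) : Measurable (weight A ω) :=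
  (measurable_weight_uncurry A).comp measurable_prodMk_left

lemma measurable_avgWeight_uncurry (A : Model S H) (m : ℕ) :
    Measurable fun p : (ℤ → H) × (Fin m → S × H) => avgWeight A p.1 p.2 :=
  (Finset.measurable_sum _ fun j _ => (measurable_weight_uncurry A).comp
    (measurable_fst.prodMk ((measurable_pi_apply j).comp measurable_snd))).const_mul _

lemma measurable_avgWeight (A : Model S H) (m : ℕ) (ω : ℤ → H) :
    Measurable fun x : Fin m → S × H => avgWeight A ω x :=
  (Finset.measurable_sum _ fun j _ => (measurable_weight A ω).comp
    (measurable_pi_apply j)).const_mul _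

lemma lintegral_avgWeight (A : Model S H) {m : ℕ} (hm : m ≠ 0) (ω : ℤ → H) (μ : Measure (S × H))
    [IsProbabilityMeasure μ] :
    ∫⁻ x, avgWeight A ω x ∂Measure.pi (fun _ : Fin m => μ) = ∫⁻ x, weight A ω x ∂μ :=
  lintegral_average μ (measurable_weight A ω) hm

omit [SecondCountableTopology H] [BorelSpace H] in
lemma Qiter_succ (A : Model S H) (n : ℕ) (ω : ℤ → H) (x : S × H) :
    Qiter A (n + 1) ω x = weight A ω x * ∫⁻ y, Qiter A n (shift ω) y ∂A.M (ω, x) := by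
  rw [Qiter, Q, lintegral_smul_measure, smul_eq_mul]

lemma measurable_Qiter (A : Model S H) (n : ℕ) :
    Measurable fun p : (ℤ → H) × (S × H) => Qiter A n p.1 p.2 := by
  have := A.markov_M
  induction n with
  | zero => exact measurable_const
  | succ n ih =>
    have hs : Measurable fun q : ((ℤ → H) × (S × H)) × (S × H) => (shift q.1.1, q.2) :=
      (measurable_shift.comp (measurable_fst.comp measurable_fst)).prodMk measurable_snd
    have h1 : Measurable fun p : (ℤ → H) × (S × H) =>
        ∫⁻ y, Qiter A n (shift p.1) y ∂A.M p :=
      (ih.comp hs).lintegral_kernel_prod_right' (κ := A.M)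
    simp only [Qiter_succ]
    exact (measurable_weight_uncurry A).mul h1

lemma measurable_stopTime (A : Model S H) (hA : ∀ ω, (stopSet A ω).Nonempty) :
    Measurable (stopTime A) := by
  classical
  have h1 : stopTime A = fun ω => Nat.find (hA ω) := by
    funext ω
    rw [stopTime, Nat.sInf_def (hA ω)]
  rw [h1]
  refine measurable_find _ fun p => ?_
  have hm : Measurable fun ω : ℤ → H =>
      ∑ i ∈ Finset.range p, weight A ω (A.particle ω i) :=
    Finset.measurable_sum _ fun i _ => (measurable_weight_uncurry A).comp
      (measurable_id.prodMk ((measurable_pi_apply i).comp A.measurable_particle))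
  exact (MeasurableSet.const _).inter (measurableSet_le measurable_const hm)

lemma measurable_size (A : Model S H) (hA : ∀ ω, (stopSet A ω).Nonempty) :
    Measurable (size A) :=
  (measurable_of_countable fun n : ℕ => n - 1).comp (measurable_stopTime A hA)

lemma measurable_selMut (A : Model S H) (m : ℕ) :
    Measurable fun p : (ℤ → H) × (Fin m → S × H) => selMut A p.1 p.2 := by
  refine Measure.measurable_of_measurable_coe _ fun s hs => ?_
  simp only [selMut_apply]
  refine (measurable_avgWeight_uncurry A m).inv.mul (Measurable.const_mul ?_ _)
  refine Finset.measurable_sum _ fun j _ => ?_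
  have hj : Measurable fun p : (ℤ → H) × (Fin m → S × H) => (p.1, p.2 j) :=
    measurable_fst.prodMk ((measurable_pi_apply j).comp measurable_snd)
  exact ((measurable_weight_uncurry A).comp hj).mul ((A.M.measurable_coe hs).comp hj)

/-- `bigM` as a kernel. -/
noncomputable def bigMKernel (A : Model S H) (m₁ m₂ : ℕ) :
    Kernel ((ℤ → H) × (Fin m₁ → S × H)) (Fin m₂ → S × H) where
  toFun p := bigM A m₂ p.1 p.2
  measurable' := measurable_measure_pi (measurable_selMut A m₁)

instance (A : Model S H) (m₁ m₂ : ℕ) : IsFiniteKernel (bigMKernel A m₁ m₂) := by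
  refine ⟨1, ENNReal.one_lt_top, fun p => ?_⟩
  change Measure.pi (fun _ : Fin m₂ => selMut A p.1 p.2) Set.univ ≤ 1
  rw [Measure.pi_univ]
  refine Finset.prod_le_one' fun _ _ => ?_
  rw [selMut_univ]
  exact ENNReal.inv_mul_le_one _

lemma countablyGenerated_pi {ι E : Type*} [Finite ι] [mE : MeasurableSpace E]
    [hE : MeasurableSpace.CountablyGenerated E] :
    MeasurableSpace.CountablyGenerated (ι → E) := by
  obtain ⟨b, hb, hgen⟩ := hE.isCountablyGenerated
  refine ⟨⟨⋃ i : ι, Set.preimage (Function.eval i) '' b,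
    Set.countable_iUnion fun i => hb.image _, ?_⟩⟩
  rw [← MeasurableSpace.iSup_generateFrom, MeasurableSpace.pi]
  refine iSup_congr fun i => ?_
  rw [← MeasurableSpace.comap_generateFrom, ← hgen]

/-- The density `phi` is chosen separately for each `(ω, x)`, so its joint measurability is not
available. Countable generation provides a jointly measurable derivative of kernels, almost
everywhere equal to it, which gives the same integrals. -/
lemma measurable_lintegral_bigR [MeasurableSpace.CountablyGenerated S] (A : Model S H)
    (K : Proposal S H) {m₁ m₂ : ℕ} [IsFiniteKernel (K m₁ m₂)]
    {F : (ℤ → H) × (Fin m₂ → S × H) → ℝ≥0∞} (hF : Measurable F) :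
    Measurable fun p : (ℤ → H) × (Fin m₁ → S × H) =>
      ∫⁻ y, F (shift p.1, y) ∂bigR A K m₂ p.1 p.2 := by
  have := countablyGenerated_pi (ι := Fin m₂) (E := S × H)
  set D := (bigMKernel A m₁ m₂).rnDeriv (K m₁ m₂) with hD
  have h1 : (fun p : (ℤ → H) × (Fin m₁ → S × H) =>
      ∫⁻ y, F (shift p.1, y) ∂bigR A K m₂ p.1 p.2)
      = fun p => avgWeight A p.1 p.2 ^ 2 * ∫⁻ y, D p y ^ 2 * F (shift p.1, y) ∂K m₁ m₂ p := by
    funext p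
    rw [bigR_eq_smul, lintegral_smul_measure, smul_eq_mul,
      lintegral_withDensity_eq_lintegral_mul _ ((measurable_phi K).pow_const 2)
        (g := fun y => F (shift p.1, y)) (hF.comp measurable_prodMk_left)]
    congr 1
    refine lintegral_congr_ae ?_
    filter_upwards [Kernel.rnDeriv_eq_rnDeriv_measure (κ := bigMKernel A m₁ m₂)
      (η := K m₁ m₂) (a := p)] with y hy
    rw [hD, hy]
    rfl
  rw [h1]
  refine ((measurable_avgWeight_uncurry A m₁).pow_const 2).mul ?_
  refine Measurable.lintegral_kernel_prod_right (κ := K m₁ m₂)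
    (f := fun (p : (ℤ → H) × (Fin m₁ → S × H)) y => D p y ^ 2 * F (shift p.1, y)) ?_
  exact ((Kernel.measurable_rnDeriv _ _).pow_const 2).mul (hF.comp
    ((measurable_shift.comp (measurable_fst.comp measurable_fst)).prodMk measurable_snd))

/-- `Riter` started from an arbitrary number `m` of particles. -/
noncomputable def RiterFrom (A : Model S H) (K : Proposal S H) :
    ℕ → (m : ℕ) → (ω : ℤ → H) → (Fin m → S × H) → ℝ≥0∞
  | 0, _, _, _ => 1
  | n + 1, _, ω, x =>
    ∫⁻ y, RiterFrom A K n (size A (shift ω)) (shift ω) y ∂bigR A K (size A (shift ω)) ω x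

-- The domain of `Riter` varies with `ω`, whereas `RiterFrom` lives on a fixed product space, where
-- joint measurability makes sense. Only the kernels at particle numbers that occur matter, so the
-- others may be replaced at will.
omit [SecondCountableTopology H] [BorelSpace H] in
lemma RiterFrom_eq_Riter (A : Model S H) (K K' : Proposal S H)
    (hK : ∀ ω, K' (size A ω) (size A (shift ω)) = K (size A ω) (size A (shift ω)))
    (n : ℕ) (ω : ℤ → H) (x : Fin (size A ω) → S × H) :
    RiterFrom A K' n (size A ω) ω x = Riter A K n ω x := by
  induction n generalizing ω with
  | zero => rfl
  | succ n ih =>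
    rw [RiterFrom, Riter]
    simp only [ih, bigR, phi, hK]

lemma measurable_comp_size {α β : Type*} [MeasurableSpace α] [MeasurableSpace β] {s : α → ℕ}
    (hs : Measurable s) {G : ℕ → α → β} (hG : ∀ k, Measurable (G k)) :
    Measurable fun a => G (s a) a :=
  (measurable_from_prod_countable_right (f := fun p : ℕ × α => G p.1 p.2) hG).comp
    (hs.prodMk measurable_id)

lemma measurable_RiterFrom [MeasurableSpace.CountablyGenerated S] (A : Model S H)
    (hA : ∀ ω, (stopSet A ω).Nonempty) (K : Proposal S H)
    (hK : ∀ m₁ m₂, IsFiniteKernel (K m₁ m₂)) (n m : ℕ) :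
    Measurable fun p : (ℤ → H) × (Fin m → S × H) => RiterFrom A K n m p.1 p.2 := by
  induction n generalizing m with
  | zero => exact measurable_const
  | succ n ih =>
    exact measurable_comp_size (s := fun p : (ℤ → H) × (Fin m → S × H) => size A (shift p.1))
      (G := fun k p => ∫⁻ y, RiterFrom A K n k (shift p.1) y ∂bigR A K k p.1 p.2)
      ((measurable_size A hA).comp (measurable_shift.comp measurable_fst))
      fun k => measurable_lintegral_bigR A K (ih k)

end Measurability

end AliveFilter

/-! ### Reference measures for the second-moment kernel, and the lower bound by Jensen. -/

namespace AliveFilter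

variable {S H : Type*} [MeasurableSpace S] [MeasurableSpace H] [MetricSpace H]

/-- The measure `η` controls the second-moment kernel for particle numbers `m₁`, `m₂` up to the
factor `C`, uniformly in the observations. -/
structure IsReference (A : Model S H) (K : Proposal S H) (m₁ m₂ : ℕ)
    (η : Measure (Fin m₂ → S × H)) (C : ℝ≥0) : Prop where
  lower : ∀ ω (x : Fin m₁ → S × H),
    avgWeight A ω x ^ 2 • η ≤ (C : ℝ≥0∞) • bigR A K m₂ ω x
  upper : ∀ ω (x : Fin m₁ → S × H),
    bigR A K m₂ ω x ≤ ((C : ℝ≥0∞) * avgWeight A ω x ^ 2) • η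
  mass_le : η Set.univ ≤ C
  one_le : ∀ ω, 1 ≤ C * ∫⁻ y, avgWeight A ω y ^ 2 ∂η

lemma IsReference.mono {A : Model S H} {K : Proposal S H} {m₁ m₂ : ℕ}
    {η : Measure (Fin m₂ → S × H)} {C C' : ℝ≥0} (h : IsReference A K m₁ m₂ η C) (hC : C ≤ C') :
    IsReference A K m₁ m₂ η C' := by
  have hC' : (C : ℝ≥0∞) ≤ C' := by exact_mod_cast hC
  refine ⟨fun ω x => (h.lower ω x).trans fun s => ?_, fun ω x => (h.upper ω x).trans fun s => ?_,
    h.mass_le.trans hC', fun ω => (h.one_le ω).trans (mul_le_mul' hC' le_rfl)⟩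
  · simp only [Measure.smul_apply, smul_eq_mul]
    exact mul_le_mul' hC' le_rfl
  · simp only [Measure.smul_apply, smul_eq_mul]
    exact mul_le_mul' (mul_le_mul' hC' le_rfl) le_rfl

section Bounds

variable {A : Model S H} {ν : Measure (S × H)} [IsProbabilityMeasure ν] {m₁ m₂ : ℕ} {ω : ℤ → H}
  {x : Fin m₁ → S × H}

lemma smul_pi_le_bigM {e₁ : ℝ≥0} (he : ∀ x, e₁ • ν ≤ A.M (ω, x)) (h : avgWeight A ω x ≠ 0) :
    e₁ ^ m₂ • Measure.pi (fun _ : Fin m₂ => ν) ≤ bigM A m₂ ω x := by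
  have := measure_pi_smul (ι := Fin m₂) e₁ ν
  rw [Fintype.card_fin] at this
  rw [← this]
  exact measure_pi_mono fun _ => smul_le_selMut he h

lemma bigM_le_smul_pi {e₂ : ℝ≥0} (he : ∀ x, A.M (ω, x) ≤ e₂ • ν) (h : avgWeight A ω x ≠ 0) :
    bigM A m₂ ω x ≤ e₂ ^ m₂ • Measure.pi (fun _ : Fin m₂ => ν) := by
  have := measure_pi_smul (ι := Fin m₂) e₂ ν
  rw [Fintype.card_fin] at this
  rw [← this]
  exact measure_pi_mono fun _ => selMut_le_smul he h

lemma absolutelyContinuous_of_smul_le {Y : Type*} [MeasurableSpace Y] {μ κ : Measure Y} {t : ℝ≥0}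
    (ht : 0 < t) (h : t • μ ≤ κ) : μ ≪ κ := by
  intro s hs
  have h1 := h s
  rw [hs, Measure.smul_apply, ENNReal.smul_def, smul_eq_mul, nonpos_iff_eq_zero, mul_eq_zero] at h1
  exact h1.resolve_left (by exact_mod_cast ht.ne')

lemma absolutelyContinuous_of_le_smul {Y : Type*} [MeasurableSpace Y] {μ κ : Measure Y} {t : ℝ≥0}
    (h : κ ≤ t • μ) : κ ≪ μ :=
  (Measure.absolutelyContinuous_of_le h).trans Measure.smul_absolutelyContinuous

lemma bigM_absolutelyContinuous {e₂ : ℝ≥0} (he : ∀ x, A.M (ω, x) ≤ e₂ • ν)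
    (h : avgWeight A ω x ≠ 0) {K : Kernel ((ℤ → H) × (Fin m₁ → S × H)) (Fin m₂ → S × H)}
    (hK : MemClass ν K) : bigM A m₂ ω x ≪ K (ω, x) := by
  obtain ⟨-, t₁, t₂, νt, ht₁, -, -, ht, hac, -⟩ := hK
  exact ((absolutelyContinuous_of_le_smul (bigM_le_smul_pi he h)).trans hac).trans
    (absolutelyContinuous_of_smul_le ht₁ (ht ω x).1)

variable [SecondCountableTopology H] [BorelSpace H]

/-- The reference measure has density `(dν^{⊗m₂}/dν̃)²` with respect to `ν̃`. The comparisons of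
squared densities apply because `bigM` lies between `e₁ ^ m₂` and `e₂ ^ m₂` times `ν^{⊗m₂}`. -/
lemma exists_isReference {e₁ e₂ g : ℝ≥0} (he₁ : 0 < e₁)
    (he : ∀ ω x, e₁ • ν ≤ A.M (ω, x) ∧ A.M (ω, x) ≤ e₂ • ν) (hg : 0 < g)
    (hgW : ∀ ω, (g : ℝ≥0∞) ≤ ∫⁻ x, weight A ω x ∂ν) (hm₂ : m₂ ≠ 0) (K : Proposal S H)
    (hK : MemClass ν (K m₁ m₂)) :
    ∃ (η : Measure (Fin m₂ → S × H)) (C : ℝ≥0), IsFiniteMeasure η ∧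
      IsReference A K m₁ m₂ η C := by
  have hK' := hK
  obtain ⟨hmk, t₁, t₂, νt, ht₁, -, hνt, ht, hac, hfin⟩ := hK'
  set π : Measure (Fin m₂ → S × H) := Measure.pi (fun _ => ν) with hπ
  set η := νt.withDensity (fun y => π.rnDeriv νt y ^ 2) with hη
  have hη1 : η Set.univ < ∞ := by
    rw [hη, withDensity_apply _ MeasurableSet.univ, Measure.restrict_univ]
    exact hfin
  have hlow : ∀ ω (x : Fin m₁ → S × H), avgWeight A ω x ^ 2 • η
      ≤ (((t₁ * (e₁ ^ m₂) ^ 2)⁻¹ * t₂ ^ 2 : ℝ≥0) : ℝ≥0∞) • bigR A K m₂ ω x := by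
    intro ω x
    -- If all weights vanish, the lower bound for `bigM` is unavailable, but the left side is zero.
    rcases eq_or_ne (avgWeight A ω x) 0 with h0 | h0
    · intro s
      simp [h0]
    have h1 := smul_withDensity_sq_le (b := bigM A m₂ ω x) (κ := K m₁ m₂ (ω, x)) (νt := νt)
      (π := π) (smul_pi_le_bigM (fun x => (he ω x).1) h0) (ht ω x).1 (ht ω x).2 hac
      (bigM_absolutelyContinuous (fun x => (he ω x).2) h0 hK)
    rw [bigR_eq_smul]
    intro s
    have h2 := h1 s
    have hc : t₁ * (e₁ ^ m₂) ^ 2 ≠ 0 := by positivity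
    simp only [Measure.smul_apply, ENNReal.smul_def, smul_eq_mul] at h2 ⊢
    calc avgWeight A ω x ^ 2 * η s
        = avgWeight A ω x ^ 2 * (((t₁ * (e₁ ^ m₂) ^ 2)⁻¹ : ℝ≥0)
          * (((t₁ * (e₁ ^ m₂) ^ 2 : ℝ≥0) : ℝ≥0∞) * η s)) := by
          rw [← mul_assoc (((t₁ * (e₁ ^ m₂) ^ 2)⁻¹ : ℝ≥0) : ℝ≥0∞), ← ENNReal.coe_mul,
            inv_mul_cancel₀ hc, ENNReal.coe_one, one_mul]
      _ ≤ _ := mul_le_mul' le_rfl (mul_le_mul' le_rfl h2)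
      _ = _ := by
          rw [ENNReal.coe_mul _ (t₂ ^ 2)]
          simp only [phi]
          ring
  have hup : ∀ ω (x : Fin m₁ → S × H), bigR A K m₂ ω x
      ≤ ((((t₁ ^ 2)⁻¹ * (t₂ * (e₂ ^ m₂) ^ 2) : ℝ≥0) : ℝ≥0∞) * avgWeight A ω x ^ 2) • η := by
    intro ω x
    rw [bigR_eq_smul]
    rcases eq_or_ne (avgWeight A ω x) 0 with h0 | h0
    · intro s
      simp [h0]
    have h1 := withDensity_sq_le_smul (b := bigM A m₂ ω x) (κ := K m₁ m₂ (ω, x)) (νt := νt)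
      (π := π) (bigM_le_smul_pi (fun x => (he ω x).2) h0) (ht ω x).1 (ht ω x).2 hac
      (bigM_absolutelyContinuous (fun x => (he ω x).2) h0 hK)
    intro s
    have h2 := h1 s
    have hc : t₁ ^ 2 ≠ 0 := by positivity
    simp only [Measure.smul_apply, ENNReal.smul_def, smul_eq_mul] at h2 ⊢
    calc avgWeight A ω x ^ 2 * (K m₁ m₂ (ω, x)).withDensity (fun y => phi A K ω x y ^ 2) s
        = avgWeight A ω x ^ 2 * (((t₁ ^ 2)⁻¹ : ℝ≥0) * (((t₁ ^ 2 : ℝ≥0) : ℝ≥0∞)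
          * (K m₁ m₂ (ω, x)).withDensity (fun y => phi A K ω x y ^ 2) s)) := by
          rw [← mul_assoc (((t₁ ^ 2)⁻¹ : ℝ≥0) : ℝ≥0∞), ← ENNReal.coe_mul,
            inv_mul_cancel₀ hc, ENNReal.coe_one, one_mul]
      _ ≤ avgWeight A ω x ^ 2 * (((t₁ ^ 2)⁻¹ : ℝ≥0) * (((t₂ * (e₂ ^ m₂) ^ 2 : ℝ≥0) : ℝ≥0∞)
          * η s)) := mul_le_mul' le_rfl (mul_le_mul' le_rfl h2)
      _ = _ := by
          rw [ENNReal.coe_mul _ (t₂ * _)]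
          ring
  have hone : ∀ ω, 1 ≤ (((g ^ 2)⁻¹ : ℝ≥0) : ℝ≥0∞) * ∫⁻ y, avgWeight A ω y ^ 2 ∂η := by
    intro ω
    -- The mean of `avgWeight` under `ν^{⊗m₂}` is `ν(W) ≥ g`. Written as an integral against `ν̃`
    -- and squared, it is bounded by Jensen's inequality, and the squared density reassembles `η`.
    have h1 : (g : ℝ≥0∞) ^ 2 ≤ ∫⁻ y, avgWeight A ω y ^ 2 ∂η := by
      calc (g : ℝ≥0∞) ^ 2 ≤ (∫⁻ y, avgWeight A ω y ∂π) ^ 2 := by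
            rw [hπ, lintegral_avgWeight A hm₂]
            gcongr
            exact hgW ω
        _ = (∫⁻ y, π.rnDeriv νt y * avgWeight A ω y ∂νt) ^ 2 := by
            rw [lintegral_rnDeriv_mul hac (measurable_avgWeight A m₂ ω).aemeasurable]
        _ ≤ ∫⁻ y, (π.rnDeriv νt y * avgWeight A ω y) ^ 2 ∂νt := sq_lintegral_le νt _
        _ = ∫⁻ y, avgWeight A ω y ^ 2 ∂η := by
            rw [hη, lintegral_withDensity_eq_lintegral_mul _
              ((Measure.measurable_rnDeriv _ _).pow_const 2)
              ((measurable_avgWeight A m₂ ω).pow_const 2)]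
            simp only [Pi.mul_apply, mul_pow]
    have hg0 : g ^ 2 ≠ 0 := by positivity
    calc (1 : ℝ≥0∞) = (((g ^ 2)⁻¹ : ℝ≥0) : ℝ≥0∞) * (g : ℝ≥0∞) ^ 2 := by
          rw [← ENNReal.coe_pow, ← ENNReal.coe_mul, inv_mul_cancel₀ hg0, ENNReal.coe_one]
      _ ≤ _ := mul_le_mul' le_rfl h1
  set C₁ := (t₁ * (e₁ ^ m₂) ^ 2)⁻¹ * t₂ ^ 2
  set C₂ := (t₁ ^ 2)⁻¹ * (t₂ * (e₂ ^ m₂) ^ 2)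
  set C₃ := (g ^ 2)⁻¹
  set C₄ := (η Set.univ).toNNReal with hC₄
  refine ⟨η, C₁ + C₂ + C₃ + C₄, ⟨hη1⟩, ?_, ?_, ?_, ?_⟩
  · intro ω x
    refine (hlow ω x).trans fun s => ?_
    simp only [Measure.smul_apply, smul_eq_mul]
    refine mul_le_mul' (ENNReal.coe_le_coe.2 ?_) le_rfl
    rw [add_assoc, add_assoc]
    exact le_self_add
  · intro ω x
    refine (hup ω x).trans fun s => ?_
    simp only [Measure.smul_apply, smul_eq_mul]
    refine mul_le_mul' (mul_le_mul' (ENNReal.coe_le_coe.2 ?_) le_rfl) le_rfl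
    rw [add_assoc]
    exact le_add_self.trans le_self_add
  · rw [← ENNReal.coe_toNNReal hη1.ne, ← hC₄]
    exact ENNReal.coe_le_coe.2 le_add_self
  · intro ω
    refine (hone ω).trans (mul_le_mul' (ENNReal.coe_le_coe.2 ?_) le_rfl)
    exact le_add_self.trans le_self_add

/-- The second-moment recursion dominates the square of the unbiased estimate. -/
lemma sq_average_Qiter_le_Riter {e₂ : ℝ≥0} (he : ∀ ω x, A.M (ω, x) ≤ e₂ • ν)
    (hsize : ∀ ω, size A ω ≠ 0) {K : Proposal S H}
    (hK : ∀ ω, MemClass ν (K (size A ω) (size A (shift ω)))) (n : ℕ) (ω : ℤ → H)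
    (x : Fin (size A ω) → S × H) :
    (((size A ω : ℕ) : ℝ≥0∞)⁻¹ * ∑ j, Qiter A n ω (x j)) ^ 2 ≤ Riter A K n ω x := by
  induction n generalizing ω with
  | zero =>
    simp only [Qiter, Riter, Finset.sum_const, Finset.card_univ, Fintype.card_fin, nsmul_eq_mul,
      mul_one]
    rw [ENNReal.inv_mul_cancel (by exact_mod_cast hsize ω) (ENNReal.natCast_ne_top _), one_pow]
  | succ n ih =>
    rcases eq_or_ne (avgWeight A ω x) 0 with h0 | h0
    · have hw : ∀ j, weight A ω (x j) = 0 := by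
        have h1 : ∑ j, weight A ω (x j) = 0 :=
          (mul_eq_zero.1 h0).resolve_left (ENNReal.inv_ne_zero.2 (ENNReal.natCast_ne_top _))
        simpa using h1
      simp [Qiter_succ, hw]
    · have hq : Measurable (Qiter A n (shift ω)) :=
        (measurable_Qiter A n).comp measurable_prodMk_left
      have := isProbabilityMeasure_selMut h0
      have := (hK ω).1
      set G : (Fin (size A (shift ω)) → S × H) → ℝ≥0∞ := fun y =>
        ((size A (shift ω) : ℕ) : ℝ≥0∞)⁻¹ * ∑ j, Qiter A n (shift ω) (y j) with hG
      have hGm : Measurable G :=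
        (Finset.measurable_sum _ fun j _ => hq.comp (measurable_pi_apply j)).const_mul _
      -- One-step unbiasedness: the factor `avgWeight` cancels the normalisation of `selMut`. What
      -- remains is a change of measure from `bigM` to `K` and Jensen's inequality under `K`.
      have h1 : ((size A ω : ℕ) : ℝ≥0∞)⁻¹ * ∑ j, Qiter A (n + 1) ω (x j)
          = avgWeight A ω x * ∫⁻ y, G y ∂bigM A (size A (shift ω)) ω x := by
        rw [bigM, hG, lintegral_average _ hq (hsize (shift ω)), lintegral_selMut, ← mul_assoc,
          ENNReal.mul_inv_cancel h0 (avgWeight_ne_top A ω x), one_mul]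
        simp only [Qiter_succ]
      rw [h1, ← lintegral_rnDeriv_mul (bigM_absolutelyContinuous (he ω) h0 (hK ω))
        hGm.aemeasurable, mul_pow, Riter, bigR_eq_smul, lintegral_smul_measure, smul_eq_mul]
      refine mul_le_mul' le_rfl ?_
      calc (∫⁻ y, phi A K ω x y * G y ∂K _ _ (ω, x)) ^ 2
          ≤ ∫⁻ y, (phi A K ω x y * G y) ^ 2 ∂K _ _ (ω, x) := sq_lintegral_le _ _
        _ = ∫⁻ y, G y ^ 2 ∂(K _ _ (ω, x)).withDensity (fun y => phi A K ω x y ^ 2) := by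
            rw [lintegral_withDensity_eq_lintegral_mul _ ((measurable_phi K).pow_const 2)
              (hGm.pow_const 2)]
            simp only [Pi.mul_apply, mul_pow]
        _ ≤ _ := lintegral_mono fun y => ih (shift ω) y

lemma sq_normConst_le_secondMoment {e₂ : ℝ≥0} (he : ∀ ω x, A.M (ω, x) ≤ e₂ • ν)
    (hsize : ∀ ω, size A ω ≠ 0) {K : Proposal S H}
    (hK : ∀ ω, MemClass ν (K (size A ω) (size A (shift ω)))) (μ : Measure (S × H))
    [IsProbabilityMeasure μ] (n : ℕ) (ω : ℤ → H) :
    normConst A μ n ω ^ 2 ≤ secondMoment A K μ n ω := by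
  have hq : Measurable (Qiter A n ω) := (measurable_Qiter A n).comp measurable_prodMk_left
  rw [normConst, ← lintegral_average μ hq (hsize ω)]
  exact (sq_lintegral_le _ _).trans
    (lintegral_mono fun x => sq_average_Qiter_le_Riter he hsize hK n ω x)

end Bounds

lemma HasExponent.div_sq {a b : ℕ → ℝ≥0∞} {c d : ℝ} (ha : HasExponent a c)
    (hb : HasExponent b d) : HasExponent (fun n => a n / b n ^ 2) (c - 2 * d) := by
  refine ⟨fun n => ⟨?_, ?_⟩, ?_⟩
  · exact ENNReal.div_ne_zero.2 ⟨(ha.1 n).1, ENNReal.pow_ne_top (hb.1 n).2⟩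
  · exact ENNReal.div_ne_top (ha.1 n).2 (pow_ne_zero 2 (hb.1 n).1)
  · refine (ha.2.sub (hb.2.const_mul 2)).congr fun n => ?_
    have h1 := (ENNReal.toReal_pos (ha.1 n).1 (ha.1 n).2).ne'
    have h2 := (ENNReal.toReal_pos (hb.1 n).1 (hb.1 n).2).ne'
    rw [ENNReal.toReal_div, ENNReal.toReal_pow, Real.log_div h1 (pow_ne_zero 2 h2), Real.log_pow]
    push_cast
    ring

lemma HasExponent.nonneg {a : ℕ → ℝ≥0∞} {c : ℝ} (ha : HasExponent a c) (h : ∀ n, 1 ≤ a n) :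
    0 ≤ c := by
  refine ge_of_tendsto' ha.2 fun n => mul_nonneg (by positivity) (Real.log_nonneg ?_)
  have := ENNReal.toReal_mono (ha.1 n).2 (h n)
  simpa using this

/-! ### The two mixing cocycles and the measurability of their masses. -/

section Cocycles

variable {A : Model S H} {ν : Measure (S × H)} [IsProbabilityMeasure ν]

/-- As `N > 1`, at least one particle remains after the last one is deleted. -/
lemma size_ne_zero (hA : BoundedRunningTime A) (ω : ℤ → H) : size A ω ≠ 0 := by
  have h1 : stopTime A ω ∈ stopSet A ω := Nat.sInf_mem (hA.2.1 ω)
  have h2 : A.N ≤ stopTime A ω := h1.1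
  have h3 := hA.1
  unfold size
  omega

/-- The summands of the constant serve, in order, the lower bound, the upper bound, the
nondegeneracy of the weight, and the total mass of `ν`. -/
lemma mixingCocycle_Q {e₁ e₂ g : ℝ≥0} (he₁ : 0 < e₁)
    (he : ∀ ω x, e₁ • ν ≤ A.M (ω, x) ∧ A.M (ω, x) ≤ e₂ • ν) (hg : 0 < g)
    (hgW : ∀ ω, (g : ℝ≥0∞) ≤ ∫⁻ x, weight A ω x ∂ν) :
    MixingCocycle shift (fun _ => S × H) (Q A) (Qiter A) (weight A) (fun _ => ν)
      (e₁⁻¹ + e₂ + g⁻¹ + 1) where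
  zero _ _ := rfl
  succ _ _ _ := rfl
  weight_le := weight_le_one A
  lower ω x := by
    intro s
    have h1 := (he ω x).1 s
    simp only [Q, Measure.smul_apply, ENNReal.smul_def, smul_eq_mul] at h1 ⊢
    calc weight A ω x * ν s = weight A ω x * ((e₁⁻¹ : ℝ≥0) * (e₁ * ν s)) := by
          rw [← mul_assoc ((e₁⁻¹ : ℝ≥0) : ℝ≥0∞), ← ENNReal.coe_mul, inv_mul_cancel₀ he₁.ne',
            ENNReal.coe_one, one_mul]
      _ ≤ weight A ω x * ((e₁⁻¹ : ℝ≥0) * A.M (ω, x) s) :=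
          mul_le_mul' le_rfl (mul_le_mul' le_rfl h1)
      _ = (e₁⁻¹ : ℝ≥0) * (weight A ω x * A.M (ω, x) s) := by ring
      _ ≤ _ := by
          refine mul_le_mul' (ENNReal.coe_le_coe.2 ?_) le_rfl
          rw [add_assoc, add_assoc]
          exact le_self_add
  upper ω x := by
    intro s
    have h1 := (he ω x).2 s
    simp only [Q, Measure.smul_apply, ENNReal.smul_def, smul_eq_mul] at h1 ⊢
    calc weight A ω x * A.M (ω, x) s ≤ weight A ω x * (e₂ * ν s) := mul_le_mul' le_rfl h1
      _ = e₂ * weight A ω x * ν s := by ring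
      _ ≤ _ := by
          refine mul_le_mul' (mul_le_mul' (ENNReal.coe_le_coe.2 ?_) le_rfl) le_rfl
          rw [add_assoc]
          exact le_add_self.trans le_self_add
  mass_le _ := by
    rw [measure_univ, ← ENNReal.coe_one]
    exact ENNReal.coe_le_coe.2 le_add_self
  one_le ω := by
    calc (1 : ℝ≥0∞) = (g⁻¹ : ℝ≥0) * (g : ℝ≥0∞) := by
          rw [← ENNReal.coe_mul, inv_mul_cancel₀ hg.ne', ENNReal.coe_one]
      _ ≤ _ := mul_le_mul' (ENNReal.coe_le_coe.2 (le_add_self.trans le_self_add)) (hgW (shift ω))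

lemma mixingCocycle_R {K : Proposal S H} {η : ∀ _ m₂ : ℕ, Measure (Fin m₂ → S × H)} {C : ℝ≥0}
    (h : ∀ ω, IsReference A K (size A ω) (size A (shift ω)) (η (size A ω) (size A (shift ω))) C) :
    MixingCocycle shift (fun ω => Fin (size A ω) → S × H)
      (fun ω x => bigR A K (size A (shift ω)) ω x) (Riter A K) (fun ω x => avgWeight A ω x ^ 2)
      (fun ω => η (size A ω) (size A (shift ω))) C where
  zero _ _ := rfl
  succ _ _ _ := rfl
  weight_le ω x := pow_le_one₀ zero_le (avgWeight_le_one A ω x)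
  lower ω x := (h ω).lower ω x
  upper ω x := (h ω).upper ω x
  mass_le ω := (h ω).mass_le
  one_le ω := (h ω).one_le (shift ω)

variable [SecondCountableTopology H] [BorelSpace H]

/-- Reference measures for all particle numbers that occur, with a common constant. -/
lemma exists_uniform_isReference (hB2 : Mixing A ν) (hB3 : BoundedRunningTime A)
    {K : Proposal S H} (hK : ∀ ω, MemClass ν (K (size A ω) (size A (shift ω)))) :
    ∃ (η : ∀ _ m₂ : ℕ, Measure (Fin m₂ → S × H)) (C : ℝ≥0),
      (∀ m₁ m₂, IsFiniteMeasure (η m₁ m₂)) ∧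
      ∀ ω, IsReference A K (size A ω) (size A (shift ω)) (η (size A ω) (size A (shift ω))) C := by
  obtain ⟨-, ⟨e₁, e₂, he₁, -, he⟩, g, hg, hgW⟩ := hB2
  -- The choice is made per pair of particle numbers, with 0 as default, so that `η` depends on `ω`
  -- only through the sizes; this keeps the masses measurable.
  have hex : ∀ m₁ m₂, ∃ (η : Measure (Fin m₂ → S × H)) (C : ℝ≥0), IsFiniteMeasure η ∧
      (MemClass ν (K m₁ m₂) → m₂ ≠ 0 → IsReference A K m₁ m₂ η C) := by
    intro m₁ m₂
    by_cases h : MemClass ν (K m₁ m₂) ∧ m₂ ≠ 0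
    · obtain ⟨η, C, h1, h2⟩ := exists_isReference he₁ he hg hgW h.2 K h.1
      exact ⟨η, C, h1, fun _ _ => h2⟩
    · exact ⟨0, 0, inferInstance, fun h1 h2 => (h ⟨h1, h2⟩).elim⟩
  choose η C hfin href using hex
  obtain ⟨c, hc⟩ := hB3.2.2
  have hsize : ∀ ω, size A ω ∈ Finset.range (c + 1) := fun ω => by
    have := hc ω
    simp only [Finset.mem_range, size]
    omega
  refine ⟨η, ∑ m₁ ∈ Finset.range (c + 1), ∑ m₂ ∈ Finset.range (c + 1), C m₁ m₂, hfin,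
    fun ω => (href _ _ (hK ω) (size_ne_zero hB3 (shift ω))).mono ?_⟩
  exact (Finset.single_le_sum (f := fun m₂ => C (size A ω) m₂) (fun _ _ => zero_le)
    (hsize (shift ω))).trans (Finset.single_le_sum
    (f := fun m₁ => ∑ m₂ ∈ Finset.range (c + 1), C m₁ m₂) (fun _ _ => zero_le) (hsize ω))

lemma measurable_mass_Q (n : ℕ) :
    Measurable (MixingCocycle.mass shift (Qiter A) (fun _ => ν) n) := by
  have hs : Measurable fun q : (ℤ → H) × (S × H) => (shift q.1, q.2) :=
    (measurable_shift.comp measurable_fst).prodMk measurable_snd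
  exact ((measurable_Qiter A n).comp hs).lintegral_prod_right'

lemma measurable_mass_R [MeasurableSpace.CountablyGenerated S]
    (hA : ∀ ω, (stopSet A ω).Nonempty) {K : Proposal S H}
    (hK : ∀ ω, IsMarkovKernel (K (size A ω) (size A (shift ω))))
    {η : ∀ _ m₂ : ℕ, Measure (Fin m₂ → S × H)} (hη : ∀ m₁ m₂, IsFiniteMeasure (η m₁ m₂)) (n : ℕ) :
    Measurable (MixingCocycle.mass (X := fun ω => Fin (size A ω) → S × H) shift (Riter A K)
      (fun ω => η (size A ω) (size A (shift ω))) n) := by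
  classical
  -- Nothing is known of `K` at particle numbers that do not occur; setting it to zero where it is
  -- not Markov makes every member a finite kernel.
  set K' : Proposal S H := fun m₁ m₂ => if IsMarkovKernel (K m₁ m₂) then K m₁ m₂ else 0 with hK'
  have hfin : ∀ m₁ m₂, IsFiniteKernel (K' m₁ m₂) := by
    intro m₁ m₂
    by_cases h : IsMarkovKernel (K m₁ m₂)
    · simp only [hK', if_pos h]
      infer_instance
    · simp only [hK', if_neg h]
      infer_instance
  have heq : ∀ ω, K' (size A ω) (size A (shift ω)) = K (size A ω) (size A (shift ω)) :=
    fun ω => if_pos (hK ω)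
  have h1 : MixingCocycle.mass (X := fun ω => Fin (size A ω) → S × H) shift (Riter A K)
      (fun ω => η (size A ω) (size A (shift ω))) n
      = fun ω => ∫⁻ y, RiterFrom A K' n (size A (shift ω)) (shift ω) y
        ∂η (size A ω) (size A (shift ω)) := by
    funext ω
    simp only [MixingCocycle.mass, RiterFrom_eq_Riter A K K' heq]
  rw [h1]
  have hsz := measurable_size A hA
  refine measurable_comp_size (G := fun k ω => ∫⁻ y, RiterFrom A K' n (size A (shift ω)) (shift ω) y
    ∂η k (size A (shift ω))) hsz fun k => ?_
  refine measurable_comp_size (s := fun ω => size A (shift ω))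
    (G := fun l ω => ∫⁻ y, RiterFrom A K' n l (shift ω) y ∂η k l) (hsz.comp measurable_shift)
    fun l => ?_
  have hs : Measurable fun q : (ℤ → H) × (Fin l → S × H) => (shift q.1, q.2) :=
    (measurable_shift.comp measurable_fst).prodMk measurable_snd
  exact ((measurable_RiterFrom A hA K' hfin n l).comp hs).lintegral_prod_right'

end Cocycles

end AliveFilter

/-! ### The growth rates and the sign of `Υ`. -/

theorem proposition4
    {S H : Type*} [MeasurableSpace S] [MeasurableSpace.CountablyGenerated S]
    [MetricSpace H] [SecondCountableTopology H] [MeasurableSpace H] [BorelSpace H]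
    (A : AliveFilter.Model S H)
    (P : Measure (ℤ → H)) [IsProbabilityMeasure P]
    (hB1 : Ergodic AliveFilter.shift P)
    (ν : Measure (S × H)) [IsProbabilityMeasure ν]
    (hB2 : AliveFilter.Mixing A ν)
    (hB3 : AliveFilter.BoundedRunningTime A) :
    ∃ Λ : ℝ,
      (∀ μ : Measure (S × H), IsProbabilityMeasure μ →
        ∀ᵐ ω ∂P, ∫⁻ x, AliveFilter.weight A ω x ∂μ ≠ 0 →
          AliveFilter.HasExponent (fun n => AliveFilter.normConst A μ n ω) Λ) ∧
      ∀ K : AliveFilter.Proposal S H,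
        (∀ ω, AliveFilter.MemClass ν
          (K (AliveFilter.size A ω) (AliveFilter.size A (AliveFilter.shift ω)))) →
        ∃ Ξ Υ : ℝ, 0 ≤ Υ ∧ Υ = Ξ - 2 * Λ ∧
          ∀ μ : Measure (S × H), IsProbabilityMeasure μ →
            ∀ᵐ ω ∂P, ∫⁻ x, AliveFilter.weight A ω x ∂μ ≠ 0 →
              AliveFilter.HasExponent (fun n => AliveFilter.secondMoment A K μ n ω) Ξ ∧
              AliveFilter.HasExponent (fun n => AliveFilter.relSecondMoment A K μ n ω) Υ := by
  have hsize := AliveFilter.size_ne_zero hB3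
  obtain ⟨-, ⟨e₁, e₂, he₁, -, he⟩, g, hg, hgW⟩ := id hB2
  obtain ⟨Λ, hΛ⟩ := (AliveFilter.mixingCocycle_Q he₁ he hg hgW).exists_hasExponent hB1
    AliveFilter.measurable_mass_Q
  refine ⟨Λ, fun μ hμ => hΛ.mono fun ω hω => hω μ hμ, fun K hK => ?_⟩
  obtain ⟨η, C, hη, href⟩ := AliveFilter.exists_uniform_isReference hB2 hB3 hK
  obtain ⟨Ξ, hΞ⟩ := (AliveFilter.mixingCocycle_R href).exists_hasExponent hB1
    (AliveFilter.measurable_mass_R hB3.2.1 (fun ω => (hK ω).1) hη)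
  -- The exceptional null set is the same for all `μ`.
  have hboth : ∀ᵐ ω ∂P, ∀ μ : Measure (S × H), IsProbabilityMeasure μ →
      ∫⁻ x, AliveFilter.weight A ω x ∂μ ≠ 0 →
      AliveFilter.HasExponent (fun n => AliveFilter.secondMoment A K μ n ω) Ξ ∧
      AliveFilter.HasExponent (fun n => AliveFilter.relSecondMoment A K μ n ω) (Ξ - 2 * Λ) := by
    filter_upwards [hΛ, hΞ] with ω h1 h2 μ hμ hW
    -- By Jensen's inequality this integral is at least `μ(W)²`, so `μ^{⊗m}` charges the weight of
    -- the second cocycle as soon as `μ` charges that of the first.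
    have hW2 : ∫⁻ x, AliveFilter.avgWeight A ω x ^ 2
        ∂Measure.pi (fun _ : Fin (AliveFilter.size A ω) => μ) ≠ 0 := by
      intro h0
      have h3 := AliveFilter.sq_lintegral_le
        (Measure.pi (fun _ : Fin (AliveFilter.size A ω) => μ)) (AliveFilter.avgWeight A ω)
      rw [h0, AliveFilter.lintegral_avgWeight A (hsize ω), nonpos_iff_eq_zero] at h3
      exact hW (pow_eq_zero_iff two_ne_zero |>.1 h3)
    have hR : AliveFilter.HasExponent (fun n => AliveFilter.secondMoment A K μ n ω) Ξ :=
      h2 _ inferInstance hW2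
    exact ⟨hR, hR.div_sq (h1 μ hμ hW)⟩
  refine ⟨Ξ, Ξ - 2 * Λ, ?_, rfl, fun μ hμ => hboth.mono fun ω hω => hω μ hμ⟩
  -- The rate does not depend on `μ`, so its sign may be tested at one typical `ω` with `μ = ν`,
  -- which charges the weight for every `ω`.
  obtain ⟨ω, hω, hωΛ⟩ := (hboth.and hΛ).exists
  have hν : ∫⁻ x, AliveFilter.weight A ω x ∂ν ≠ 0 :=
    ((ENNReal.coe_pos.2 hg).trans_le (hgW ω)).ne'
  refine (hω ν inferInstance hν).2.nonneg fun n => ?_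
  have hn : AliveFilter.normConst A ν n ω ≠ 0 ∧ AliveFilter.normConst A ν n ω ≠ ∞ :=
    (hωΛ ν inferInstance hν).1 n
  rw [AliveFilter.relSecondMoment,
    ENNReal.le_div_iff_mul_le (Or.inl (pow_ne_zero 2 hn.1))
      (Or.inl (ENNReal.pow_ne_top hn.2)), one_mul]
  exact AliveFilter.sq_normConst_le_secondMoment (fun ω x => (he ω x).2) hsize hK ν n ω
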